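/- Let $M$ be a connected, paracompact, Hausdorff smooth manifold of dimension $n\ge 1$ with a smooth linear connection $\nabla$ (not necessarily torsion-free or metric). Suppose that $(M,\nabla)$ is pseudohadamard, i.e. every $x\in M$ is a pole: $\exp_x$ is defined on all of $T_xM$ and is a diffeomorphism $T_xM\to M$. Then: 1. $(M,\nabla)$ is nonreturning: for every $p\in M$ and every neighborhood $V$ of $p$ there is an open simple convex neighborhood $U\subseteq V$ of $p$ (any two points of $U$ are joined by exactly one geodesic segment lying in $U$) such that every nonconstant inextendible geodesic that meets $U$ leaves $U$ and, once it has left, never returns to $U$. 2. $(M,\nabla)$ is $\nabla$-pseudoconvex: for every compact $K\subseteq M$ there is a compact $K'\subseteq M$ such that every geodesic segment with both endpoints in $K$ lies entirely in $K'$. 3. The space of (unoriented) geodesics $G(M)$ is a manifold. Here $T'M$ is the tangent bundle without its zero section, $PM$ is the quotient of $T'M$ by proportionality of vectors at the same point, and $G(M)$ is the quotient of $PM$ identifying points that lie on the lift of a common inextendible geodesic, each with the quotient topology. Explicitly, $G(M)$ is Hausdorff, paracompact and connected, and it carries a smooth structure of dimension $2n-2$, compatible with its topology, for which the natural projection $T'M\to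 G(M)$ is a smooth submersion. -/

import Mathlib

open Set Filter Topology Bundle
open scoped Manifold ContDiff

noncomputable section

namespace GeodesicSpace

/-- The model vector space of an `n`-manifold. -/
abbrev Model (n : ℕ) : Type := EuclideanSpace ℝ (Fin n)

/-- A linear connection on the manifold `M`: a covariant derivative on its tangent bundle.
Smoothness is the separate class `CovariantDerivative.ContMDiffCovariantDerivative _ ∞`. -/
abbrev LinearConnection (n : ℕ) (M : Type*) [TopologicalSpace M] [ChartedSpace (Model n) M]
    [IsManifold (𝓡 n) ∞ M] : Type _ :=
  CovariantDerivative (𝓡 n) (Model n) (TangentSpace (𝓡 n) : M → Type _)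

section Geodesics

variable {n : ℕ} {M : Type*} [TopologicalSpace M] [ChartedSpace (Model n) M]
  [IsManifold (𝓡 n) ∞ M]

/-- The Christoffel symbol of `cov` at the point `y` in the chart around `x₀`: the components,
in that chart, of `∇_V W` at `y`, where `V` and `W` are the coordinate vector fields with
constant components `v` and `w`. -/
def christoffel (cov : LinearConnection n M) (x₀ y : M) (v w : Model n) : Model n :=
  let e := trivializationAt (Model n) (TangentSpace (𝓡 n) : M → Type _) x₀
  e.continuousLinearMapAt ℝ y (cov (fun z ↦ e.symmL ℝ z w) y (e.symmL ℝ y v))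

/-- The natural lift `t ↦ (γ t, γ' t)` of a curve to the tangent bundle. -/
def lift (γ : ℝ → M) (t : ℝ) : TangentBundle (𝓡 n) M :=
  ⟨γ t, mfderiv 𝓘(ℝ, ℝ) (𝓡 n) γ t (1 : ℝ)⟩

/-- `γ` is a (parametrized) geodesic on the open interval `J`: it is smooth there, and in every
chart it satisfies `u'' + Γ(u', u') = 0`. The values of `γ` outside `J` are irrelevant. -/
structure IsGeodesicOn (cov : LinearConnection n M) (γ : ℝ → M) (J : Set ℝ) : Prop where
  isOpen : IsOpen J
  ordConnected : J.OrdConnected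
  smooth : ContMDiffOn 𝓘(ℝ, ℝ) (𝓡 n) ∞ γ J
  equation : ∀ x₀ : M, ∀ t ∈ J, γ t ∈ (chartAt (Model n) x₀).source →
    let u : ℝ → Model n := fun s ↦ extChartAt (𝓡 n) x₀ (γ s)
    deriv (deriv u) t + christoffel cov x₀ (γ t) (deriv u t) (deriv u t) = 0

/-- `γ : J → M` is an inextendible geodesic. -/
structure IsMaximalGeodesic (cov : LinearConnection n M) (γ : ℝ → M) (J : Set ℝ) : Prop where
  geodesic : IsGeodesicOn cov γ J
  nonempty : J.Nonempty
  maximal : ∀ (β : ℝ → M) (J' : Set ℝ), IsGeodesicOn cov β J' → J ⊆ J' → EqOn β γ J → J' = J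

/-- `γ` restricts to a geodesic segment on the compact interval `[a, b]`. -/
def IsGeodesicSegment (cov : LinearConnection n M) (γ : ℝ → M) (a b : ℝ) : Prop :=
  a ≤ b ∧ ∃ J : Set ℝ, Icc a b ⊆ J ∧ IsGeodesicOn cov γ J

/-- The domain of `exp_x`: those `v` for which the geodesic with initial velocity `v` at `x`
is defined up to time `1`. -/
def expDomain (cov : LinearConnection n M) (x : M) : Set (TangentSpace (𝓡 n) x) :=
  {v | ∃ γ : ℝ → M, IsGeodesicSegment cov γ 0 1 ∧
    lift γ 0 = (⟨x, v⟩ : TangentBundle (𝓡 n) M)}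

open Classical in
/-- The exponential map `exp_x v = γ_v 1` (with junk value `x` off its domain). -/
def expMap (cov : LinearConnection n M) (x : M) (v : TangentSpace (𝓡 n) x) : M :=
  if h : v ∈ expDomain cov x then h.choose 1 else x

/-- `x` is a pole: `exp_x` is defined on all of `T_x M` and is a diffeomorphism onto `M`.
The type `TangentSpace (𝓡 n) x` is by definition the vector space `Model n`; the latter carries
its standard smooth structure. -/
def IsPole (cov : LinearConnection n M) (x : M) : Prop :=
  (∀ v : TangentSpace (𝓡 n) x, v ∈ expDomain cov x) ∧
    ∃ Φ : Diffeomorph 𝓘(ℝ, Model n) (𝓡 n) (Model n) M ∞,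
      ∀ v : TangentSpace (𝓡 n) x, Φ v = expMap cov x v

/-- A pseudohadamard manifold: every point is a pole. -/
def IsPseudohadamard (cov : LinearConnection n M) : Prop :=
  ∀ x : M, IsPole cov x

/-- A simple convex open set: any two of its points are joined by exactly one geodesic segment
lying in the set (segments being parametrized by `[0, 1]`). -/
def IsSimpleConvex (cov : LinearConnection n M) (U : Set M) : Prop :=
  IsOpen U ∧ ∀ x ∈ U, ∀ y ∈ U, ∃! v : TangentSpace (𝓡 n) x,
    ∃ γ : ℝ → M, IsGeodesicSegment cov γ 0 1 ∧
      lift γ 0 = (⟨x, v⟩ : TangentBundle (𝓡 n) M) ∧ γ 1 = y ∧ ∀ t ∈ Icc (0 : ℝ) 1, γ t ∈ U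

/-- `(M, ∇)` is nonreturning: every point has arbitrarily small simple convex neighborhoods such
that each nonconstant inextendible geodesic which meets the neighborhood leaves it and, once it
has left, never returns. -/
def IsNonreturning (cov : LinearConnection n M) : Prop :=
  ∀ p : M, ∀ V ∈ 𝓝 p, ∃ U : Set M, U ⊆ V ∧ p ∈ U ∧ IsSimpleConvex cov U ∧
    ∀ (γ : ℝ → M) (J : Set ℝ), IsMaximalGeodesic cov γ J → (γ '' J).Nontrivial →
      ∀ t ∈ J, γ t ∈ U →
        (∃ s ∈ J, t < s ∧ γ s ∉ U) ∧
          ∀ s ∈ J, t < s → γ s ∉ U → ∀ r ∈ J, s < r → γ r ∉ U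

/-- `(M, ∇)` is `∇`-pseudoconvex. -/
def IsPseudoconvex (cov : LinearConnection n M) : Prop :=
  ∀ K : Set M, IsCompact K → ∃ K' : Set M, IsCompact K' ∧
    ∀ (γ : ℝ → M) (a b : ℝ), IsGeodesicSegment cov γ a b → γ a ∈ K → γ b ∈ K →
      ∀ t ∈ Icc a b, γ t ∈ K'

end Geodesics

section Space

variable (n : ℕ) (M : Type*) [TopologicalSpace M] [ChartedSpace (Model n) M]
  [IsManifold (𝓡 n) ∞ M]

theorem isOpen_nonzero : IsOpen {v : TangentBundle (𝓡 n) M | v.2 ≠ 0} := by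
  rw [isOpen_iff_mem_nhds]
  intro v hv
  let e := trivializationAt (Model n) (TangentSpace (𝓡 n) : M → Type _) v.proj
  have hvs : v ∈ e.source := FiberBundle.mem_trivializationAt_proj_source
  have hlin : ∀ w ∈ e.source, ((e w).2 = 0 ↔ w.2 = 0) := by
    intro w hw
    have hb : w.proj ∈ e.baseSet := e.mem_source.1 hw
    have h : (e w).2 = e.continuousLinearEquivAt ℝ w.proj hb w.2 := rfl
    rw [h, ContinuousLinearEquiv.map_eq_zero_iff]
  have hne : ∀ᶠ w in 𝓝 v, (e w).2 ≠ 0 :=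
    (continuous_snd.continuousAt.comp (e.continuousAt hvs)).eventually_ne
      (fun h ↦ hv ((hlin v hvs).1 h))
  filter_upwards [hne, e.open_source.mem_nhds hvs] with w hw hws h0
  exact hw ((hlin w hws).2 h0)

/-- The reduced tangent bundle `T'M`: the tangent bundle less the zero section, as an open
submanifold of `TM`. -/
def reducedTangentBundle : TopologicalSpace.Opens (TangentBundle (𝓡 n) M) :=
  ⟨{v | v.2 ≠ 0}, isOpen_nonzero n M⟩

/-- Proportionality of nonzero tangent vectors at the same point. -/
def proportional : Setoid (reducedTangentBundle n M) where
  r v w := ∃ c : ℝ, c ≠ 0 ∧ w.1 = ⟨v.1.proj, c • v.1.2⟩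
  iseqv :=
    { refl := fun v ↦ ⟨1, one_ne_zero, by rw [one_smul]⟩
      symm := by
        rintro ⟨⟨x, v⟩, hv⟩ ⟨w, hw⟩ ⟨c, hc, rfl⟩
        exact ⟨c⁻¹, inv_ne_zero hc, by simp [smul_smul, inv_mul_cancel₀ hc]⟩
      trans := by
        rintro ⟨⟨x, v⟩, hv⟩ ⟨w, hw⟩ ⟨z, hz⟩ ⟨c, hc, rfl⟩ ⟨d, hd, rfl⟩
        exact ⟨d * c, mul_ne_zero hd hc, by simp [smul_smul]⟩ }

/-- The projectivized tangent bundle `PM`, with the quotient topology of `T'M`. -/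
abbrev ProjectiveTangentBundle : Type _ := Quotient (proportional n M)

variable {n M}

/-- Two points of `PM` lie on the lift of a common inextendible geodesic. -/
def OnCommonGeodesic (cov : LinearConnection n M) (P Q : ProjectiveTangentBundle n M) : Prop :=
  ∃ (γ : ℝ → M) (J : Set ℝ), IsMaximalGeodesic cov γ J ∧
    ∃ s ∈ J, ∃ t ∈ J, ∃ v w : reducedTangentBundle n M,
      v.1 = lift γ s ∧ w.1 = lift γ t ∧
        P = Quotient.mk (proportional n M) v ∧ Q = Quotient.mk (proportional n M) w

/-- The space `G(M)` of unoriented geodesics, with the quotient topology of `PM`. -/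
abbrev GeodesicsOf (cov : LinearConnection n M) : Type _ := Quot (OnCommonGeodesic cov)

/-- The natural projection `T'M → G(M)`. -/
def toGeodesics (cov : LinearConnection n M) (v : reducedTangentBundle n M) : GeodesicsOf cov :=
  Quot.mk (OnCommonGeodesic cov) (Quotient.mk (proportional n M) v)

/-- `G(M)` is a manifold: Hausdorff, paracompact, connected, and locally Euclidean (of dimension
`2n - 2`), with a smooth structure, namely the quotient one, for which the natural projection
`T'M → G(M)` is a smooth submersion. -/
def GeodesicsFormManifold (cov : LinearConnection n M) : Prop :=
  T2Space (GeodesicsOf cov) ∧ ParacompactSpace (GeodesicsOf cov) ∧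
    ConnectedSpace (GeodesicsOf cov) ∧
    ∃ _ : ChartedSpace (Model (2 * n - 2)) (GeodesicsOf cov),
      IsManifold (𝓡 (2 * n - 2)) ∞ (GeodesicsOf cov) ∧
      ContMDiff (𝓡 n).tangent (𝓡 (2 * n - 2)) ∞ (toGeodesics cov) ∧
      ∀ v : reducedTangentBundle n M,
        Function.Surjective (mfderiv (𝓡 n).tangent (𝓡 (2 * n - 2)) (toGeodesics cov) v)

end Space

end GeodesicSpace

end

/-! One pole already makes the exponential map a global chart, so `M` becomes the vector space E =
`Model n` and the geodesic equation becomes y'' = X(y, y'), with X smooth and homogeneous of degree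
two in y'. Every exp_x is defined everywhere, so solutions last up to time one and, by rescaling,
forever. This gives a smooth global flow φ on E × E (`exists_isGeodesicFlow`), and `IsPoleFlow`
records all that is needed of it. The map (x, v) ↦ (x, exp_x v) is a bijection with invertible
differential. Hence `log` is jointly smooth (`contDiff_log`), and the unique segment from x to y
depends continuously on x and y.

Pseudoconvexity: segments with endpoints in K sweep out a continuous image of [0, 1] × K × K.
Nonreturning: near p the squared Euclidean distance to p is convex along geodesics, so small balls
are convex (`exists_convex_ball`). A geodesic arc with both ends in such a ball is the unique
segment between them, so it never left. It does leave eventually, because the logarithm of γ(t) from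
a fixed point of γ grows linearly in t.

The geodesic space is the quotient of the nonzero vectors by the maps "flow for time t, then scale
by c ≠ 0". From a vector and a second one in its orbit, `log` recovers t and c continuously. So the
orbit relation is closed, and with the open projection the quotient is Hausdorff. Moreover orbits do
not come back close to a vector except at parameters near (0, 1) (`eventually_small`). A small
transversal of dimension 2n - 2 therefore meets each orbit at most once (`exists_slice`), and such
transversals are the charts. Connectedness holds because the geodesics through x and those through y
always share one. -/

noncomputable section

namespace GeodesicSpace

/-! ### Smoothness of composition operators on spaces of continuous functions -/

section Nemytskii

universe u
variable {K : Type*} [TopologicalSpace K] [CompactSpace K]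
  {E F : Type u} [NormedAddCommGroup E] [NormedSpace ℝ E] [NormedAddCommGroup F] [NormedSpace ℝ F]

/-- The bilinear map on continuous functions given by pointwise application of a bilinear map. -/
def pointwiseBilin {G : Type u} [NormedAddCommGroup G] [NormedSpace ℝ G] (B : G →L[ℝ] E →L[ℝ] F) :
    C(K, G) →L[ℝ] C(K, E) →L[ℝ] C(K, F) :=
  LinearMap.mkContinuous₂
    (LinearMap.mk₂ ℝ (fun (A : C(K, G)) (h : C(K, E)) ↦
        (⟨fun s ↦ B (A s) (h s), by fun_prop⟩ : C(K, F)))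
      (fun _ _ _ ↦ by ext; simp) (fun _ _ _ ↦ by ext; simp) (fun _ _ _ ↦ by ext; simp)
      (fun _ _ _ ↦ by ext; simp)) ‖B‖ (by
    intro A h
    rw [ContinuousMap.norm_le _ (by positivity)]
    intro s
    refine (B.le_opNorm₂ _ _).trans ?_
    gcongr
    exacts [A.norm_coe_le_norm s, h.norm_coe_le_norm s])

/-- Pointwise application of a continuous family of linear maps to a continuous function. -/
def pointwiseApply : C(K, E →L[ℝ] F) →L[ℝ] C(K, E) →L[ℝ] C(K, F) :=
  pointwiseBilin (ContinuousLinearMap.id ℝ (E →L[ℝ] F))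

@[simp]
theorem pointwiseApply_apply (A : C(K, E →L[ℝ] F)) (h : C(K, E)) (s : K) :
    pointwiseApply A h s = A s (h s) := rfl

-- The mean value inequality at each s has an error governed by the oscillation of f' near γ s.
-- Continuity of η ↦ f' ∘ η in the uniform norm bounds this oscillation uniformly in s.
set_option synthInstance.maxHeartbeats 200000 in
theorem hasFDerivAt_comp_left (f : C(E, F)) (f' : C(E, E →L[ℝ] F))
    (hf : ∀ x, HasFDerivAt f (f' x) x) (γ : C(K, E)) :
    HasFDerivAt (fun η : C(K, E) ↦ f.comp η) (pointwiseApply (f'.comp γ)) γ := by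
  rw [hasFDerivAt_iff_isLittleO, Asymptotics.isLittleO_iff]
  intro ε hε
  have hc : ContinuousAt (fun η : C(K, E) ↦ f'.comp η) γ :=
    (ContinuousMap.continuous_postcomp f').continuousAt
  obtain ⟨δ, hδ, hball⟩ := (Metric.continuousAt_iff (α := C(K, E)) (β := C(K, E →L[ℝ] F))).1 hc ε hε
  filter_upwards [Metric.ball_mem_nhds γ hδ] with η hη
  rw [ContinuousMap.norm_le _ (by positivity)]
  intro s
  have key : ∀ z ∈ Metric.ball (γ s) δ, ‖f' z - f' (γ s)‖ ≤ ε := by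
    intro z hz
    -- Translating γ by the constant z - γ s gives a function δ-close to γ that takes the value z at
    -- s.
    have h1 : dist (γ + ContinuousMap.const K (z - γ s)) γ < δ := by
      rw [dist_eq_norm, add_sub_cancel_left]
      refine lt_of_le_of_lt ((ContinuousMap.norm_le _ (norm_nonneg (z - γ s))).2 fun _ ↦ le_rfl) ?_
      rwa [mem_ball_iff_norm] at hz
    have h2 : dist (f' (γ s + (z - γ s))) (f' (γ s)) ≤ _ := (ContinuousMap.dist_apply_le_dist
      (f := f'.comp (γ + ContinuousMap.const K (z - γ s))) (g := f'.comp γ) s).trans (hball h1).le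
    rwa [add_sub_cancel, dist_eq_norm] at h2
  have hηs : η s ∈ Metric.ball (γ s) δ :=
    lt_of_le_of_lt (ContinuousMap.dist_apply_le_dist s) hη
  have := (convex_ball (γ s) δ).norm_image_sub_le_of_norm_hasFDerivWithin_le'
    (fun z _ ↦ (hf z).hasFDerivWithinAt) key (Metric.mem_ball_self hδ) hηs
  calc _ = ‖f (η s) - f (γ s) - (f' (γ s)) (η s - γ s)‖ := by simp
    _ ≤ ε * ‖η s - γ s‖ := this
    _ ≤ ε * ‖η - γ‖ := by gcongr; exact (η - γ).norm_coe_le_norm s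

/-- The derivative is again a composition operator, with `fderiv ℝ f`, followed by a continuous
linear map, so induction applies. The target F varies because the step passes from F to E →L[ℝ] F;
this is why E and F share a universe. -/
theorem contDiff_comp_left_nat (n : ℕ) : ∀ {F : Type u} [NormedAddCommGroup F] [NormedSpace ℝ F]
    (f : C(E, F)), ContDiff ℝ n f → ContDiff ℝ n (fun η : C(K, E) ↦ f.comp η) := by
  induction n with
  | zero =>
    intro F _ _ f _
    exact contDiff_zero.2 (ContinuousMap.continuous_postcomp f)
  | succ n ih =>
    intro F _ _ f hf
    have hd : ContDiff ℝ n (fderiv ℝ f) := by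
      refine hf.fderiv_right ?_
      norm_cast
    have h1 := ih ⟨fderiv ℝ f, hd.continuous⟩ hd
    rw [Nat.cast_add, Nat.cast_one]
    have hne : ((n : WithTop ℕ∞) + 1) ≠ 0 := by simp
    refine contDiff_succ_iff_hasFDerivAt.2 ⟨_, pointwiseApply.contDiff.comp h1, fun γ ↦ ?_⟩
    exact hasFDerivAt_comp_left f _
      (fun x ↦ (hf.differentiable (by simp) x).hasFDerivAt) γ

theorem contDiff_comp_left (f : C(E, F)) (hf : ContDiff ℝ ∞ f) :
    ContDiff ℝ ∞ (fun η : C(K, E) ↦ f.comp η) :=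
  contDiff_infty.2 fun n ↦ contDiff_comp_left_nat n f (hf.of_le (mod_cast le_top))

end Nemytskii

/-! ### Uniqueness of solutions of autonomous equations -/

section Uniqueness

variable {F : Type*} [NormedAddCommGroup F] [NormedSpace ℝ F] [FiniteDimensional ℝ F]

/-- Both curves stay in one closed ball over the compact interval, and on that ball f is Lipschitz,
so the global Lipschitz hypothesis is not needed. -/
theorem eqOn_Icc_of_hasDerivWithinAt_Ici {f : F → F} (hf : ContDiff ℝ ∞ f) {α β : ℝ → F} {a b : ℝ}
    (hα : ContinuousOn α (Icc a b))
    (hα' : ∀ t ∈ Ico a b, HasDerivWithinAt α (f (α t)) (Ici t) t)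
    (hβ : ContinuousOn β (Icc a b))
    (hβ' : ∀ t ∈ Ico a b, HasDerivWithinAt β (f (β t)) (Ici t) t)
    (h : α a = β a) : EqOn α β (Icc a b) := by
  have hK : IsCompact (α '' Icc a b ∪ β '' Icc a b) :=
    (isCompact_Icc.image_of_continuousOn hα).union (isCompact_Icc.image_of_continuousOn hβ)
  obtain ⟨R, hR⟩ := hK.isBounded.subset_closedBall 0
  obtain ⟨L, hL⟩ := hf.contDiffOn.exists_lipschitzOnWith (by simp)
    (convex_closedBall (0 : F) R) (isCompact_closedBall _ _)
  exact ODE_solution_unique_of_mem_Icc_right (v := fun _ ↦ f) (s := fun _ ↦ Metric.closedBall 0 R)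
    (fun _ _ ↦ hL) hα hα' (fun t ht ↦ hR (Or.inl ⟨t, Ico_subset_Icc_self ht, rfl⟩))
    hβ hβ' (fun t ht ↦ hR (Or.inr ⟨t, Ico_subset_Icc_self ht, rfl⟩)) h

theorem eqOn_of_hasDerivAt {f : F → F} (hf : ContDiff ℝ ∞ f) {α β : ℝ → F} {J : Set ℝ}
    (hJ : J.OrdConnected) (hα : ∀ t ∈ J, HasDerivAt α (f (α t)) t)
    (hβ : ∀ t ∈ J, HasDerivAt β (f (β t)) t) {t₀ : ℝ} (ht₀ : t₀ ∈ J) (h : α t₀ = β t₀) :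
    EqOn α β J := by
  intro t ht
  rcases le_total t₀ t with hle | hle
  · have hs : Icc t₀ t ⊆ J := hJ.out ht₀ ht
    exact eqOn_Icc_of_hasDerivWithinAt_Ici hf
      (fun s hs' ↦ (hα s (hs hs')).continuousAt.continuousWithinAt)
      (fun s hs' ↦ (hα s (hs (Ico_subset_Icc_self hs'))).hasDerivWithinAt)
      (fun s hs' ↦ (hβ s (hs hs')).continuousAt.continuousWithinAt)
      (fun s hs' ↦ (hβ s (hs (Ico_subset_Icc_self hs'))).hasDerivWithinAt) h ⟨hle, le_rfl⟩
  -- Backward uniqueness is forward uniqueness for -f after reversing time.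
  · have hs : ∀ s ∈ Icc (-t₀) (-t), -s ∈ J := fun s hs' ↦
      hJ.out ht ht₀ ⟨by linarith [hs'.2], by linarith [hs'.1]⟩
    have hneg : ∀ {δ : ℝ → F}, (∀ t ∈ J, HasDerivAt δ (f (δ t)) t) → ∀ s ∈ Icc (-t₀) (-t),
        HasDerivAt (fun s ↦ δ (-s)) (-f (δ (-s))) s := by
      intro δ hδ s hs'
      simpa [Function.comp_def] using (hδ _ (hs s hs')).scomp s (hasDerivAt_neg s)
    have := eqOn_Icc_of_hasDerivWithinAt_Ici (f := fun x ↦ -f x) hf.neg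
      (fun s hs' ↦ (hneg hα s hs').continuousAt.continuousWithinAt)
      (fun s hs' ↦ (hneg hα s (Ico_subset_Icc_self hs')).hasDerivWithinAt)
      (fun s hs' ↦ (hneg hβ s hs').continuousAt.continuousWithinAt)
      (fun s hs' ↦ (hneg hβ s (Ico_subset_Icc_self hs')).hasDerivWithinAt) (by simpa using h)
      (x := -t) ⟨by linarith, le_rfl⟩
    simpa using this

end Uniqueness

/-! ### Smoothness of a complete flow in time and initial point -/

section Flow

universe u
variable {F : Type u} [NormedAddCommGroup F] [NormedSpace ℝ F]

/-- The primitive `s ↦ ∫₀ˢ g` of a continuous function on the unit interval. -/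
def primitive [FiniteDimensional ℝ F] : C(unitInterval, F) →L[ℝ] C(unitInterval, F) :=
  haveI : CompleteSpace F := FiniteDimensional.complete ℝ F
  have hc : ∀ g : C(unitInterval, F), Continuous fun r : ℝ ↦ g (projIcc 0 1 zero_le_one r) :=
    fun g ↦ g.continuous.comp continuous_projIcc
  LinearMap.mkContinuous
    { toFun := fun g ↦ ⟨fun s ↦ ∫ r in (0 : ℝ)..s, g (projIcc 0 1 zero_le_one r),
        (intervalIntegral.continuous_primitive
          (fun a b ↦ (hc g).intervalIntegrable a b) 0).comp continuous_subtype_val⟩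
      map_add' := fun g h ↦ by
        ext s
        exact intervalIntegral.integral_add ((hc g).intervalIntegrable _ _)
          ((hc h).intervalIntegrable _ _)
      map_smul' := fun c g ↦ by
        ext s
        exact intervalIntegral.integral_smul c _ } 1 (by
    intro g
    rw [ContinuousMap.norm_le _ (by positivity)]
    intro s
    refine (intervalIntegral.norm_integral_le_of_norm_le_const
      (C := ‖g‖) fun r _ ↦ g.norm_coe_le_norm _).trans ?_
    rw [sub_zero, abs_of_nonneg s.2.1, one_mul]
    exact mul_le_of_le_one_right (norm_nonneg _) s.2.2)

variable [FiniteDimensional ℝ F]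

/-- The curve η(s) = φ (t s) x on [0, 1] solves η = x + t ∫ f ∘ η. At t = 0 the derivative of this
equation in η is the identity, so the implicit function theorem in C([0, 1], F) gives η as a smooth
function of (t, x). Evaluating at s = 1 gives φ t x. -/
theorem contDiffAt_flow_zero {f : F → F} (hf : ContDiff ℝ ∞ f) {φ : ℝ → F → F}
    (h0 : ∀ x, φ 0 x = x) (hφ : ∀ x t, HasDerivAt (fun s ↦ φ s x) (f (φ t x)) t) (x₀ : F) :
    ContDiffAt ℝ ∞ (fun p : ℝ × F ↦ φ p.1 p.2) (0, x₀) := by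
  have : CompleteSpace F := FiniteDimensional.complete ℝ F
  let c : F →L[ℝ] C(unitInterval, F) := ContinuousLinearMap.const ℝ unitInterval
  let fc : C(F, F) := ⟨f, hf.continuous⟩
  let Θ : (ℝ × F) × C(unitInterval, F) → C(unitInterval, F) := fun z ↦
    z.2 - c z.1.2 - z.1.1 • primitive (fc.comp z.2)
  have hΘ : ContDiff ℝ ∞ Θ := by
    have h1 : ContDiff ℝ ∞ (fun z : (ℝ × F) × C(unitInterval, F) ↦ fc.comp z.2) :=
      (contDiff_comp_left fc hf).comp contDiff_snd
    have h2 := (primitive (F := F)).contDiff.comp h1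
    have h3 : ContDiff ℝ ∞ (fun z : (ℝ × F) × C(unitInterval, F) ↦ c z.1.2) :=
      c.contDiff.comp (contDiff_snd.comp contDiff_fst)
    exact (contDiff_snd.sub h3).sub ((contDiff_fst.comp contDiff_fst).smul h2)
  let u : (ℝ × F) × C(unitInterval, F) := ((0, x₀), c x₀)
  have hu : Θ u = 0 := by simp [Θ, u]
  have hinv : (fderiv ℝ Θ u ∘L .inr ℝ (ℝ × F) C(unitInterval, F)).IsInvertible := by
    have h1 : HasFDerivAt (fun η : C(unitInterval, F) ↦ Θ (u.1, η))
        (fderiv ℝ Θ u ∘L .inr ℝ (ℝ × F) C(unitInterval, F)) u.2 :=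
      ((hΘ.differentiable (by simp) u).hasFDerivAt).comp u.2 (hasFDerivAt_prodMk_right _ _)
    have h2 : HasFDerivAt (fun η : C(unitInterval, F) ↦ Θ (u.1, η))
        (ContinuousLinearMap.id ℝ _) u.2 := by
      have : (fun η : C(unitInterval, F) ↦ Θ (u.1, η)) = fun η ↦ η - c x₀ := by
        ext η; simp [Θ, u]
      rw [this]
      exact (hasFDerivAt_id _).sub_const _
    rw [h1.unique h2]
    exact ContinuousLinearMap.isInvertible_equiv (f := ContinuousLinearEquiv.refl ℝ _)
  have hψ := hΘ.contDiffAt.contDiffAt_implicitFunction (u := u) (by simp) hinv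
  have hev := hΘ.contDiffAt.eventually_apply_implicitFunction (u := u) (by simp) hinv
  set ψ := hΘ.contDiffAt.implicitFunction (u := u) (by simp) hinv
  let ev : C(unitInterval, F) →L[ℝ] F := ContinuousMap.evalCLM ℝ (1 : unitInterval)
  have hev1 : ContDiffAt ℝ ∞ (fun z ↦ ev (ψ z)) ((0, x₀) : ℝ × F) :=
    ContDiffAt.comp (g := ev) ((0, x₀) : ℝ × F) ev.contDiff.contDiffAt hψ
  refine hev1.congr_of_eventuallyEq ?_
  filter_upwards [hev] with z hz
  rw [hu] at hz
  have heq : ∀ s : unitInterval, ψ z s = z.2 + z.1 • ∫ r in (0 : ℝ)..s,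
      f (ψ z (projIcc 0 1 zero_le_one r)) := by
    intro s
    have := DFunLike.congr_fun hz s
    simp only [Θ, ContinuousMap.sub_apply, ContinuousMap.zero_apply, sub_sub, sub_eq_zero] at this
    exact this
  have hcont : Continuous fun r : ℝ ↦ ψ z (projIcc 0 1 zero_le_one r) :=
    (ψ z).continuous.comp continuous_projIcc
  let α : ℝ → F := fun s ↦ z.2 + z.1 • ∫ r in (0 : ℝ)..s, f (ψ z (projIcc 0 1 zero_le_one r))
  have hα : ∀ s ∈ Icc (0 : ℝ) 1, α s = ψ z (projIcc 0 1 zero_le_one s) := by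
    intro s hs
    rw [projIcc_of_mem zero_le_one hs, heq]
  have hαd : ∀ s, HasDerivAt α (z.1 • f (ψ z (projIcc 0 1 zero_le_one s))) s := by
    intro s
    have := (intervalIntegral.integral_hasDerivAt_right
      ((hf.continuous.comp hcont).intervalIntegrable 0 s)
      (hf.continuous.comp hcont).stronglyMeasurable.stronglyMeasurableAtFilter
      (hf.continuous.comp hcont).continuousAt)
    exact (this.const_smul z.1).const_add z.2
  have hβd : ∀ s, HasDerivAt (fun s ↦ φ (z.1 * s) z.2) (z.1 • f (φ (z.1 * s) z.2)) s := by
    intro s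
    have := (hφ z.2 (z.1 * s)).scomp s ((hasDerivAt_id s).const_mul z.1)
    simpa [Function.comp_def] using this
  -- Uniqueness for the field z.1 • f identifies the implicit solution with the rescaled flow line.
  have := eqOn_Icc_of_hasDerivWithinAt_Ici (f := fun x ↦ z.1 • f x) (hf.const_smul z.1)
    (a := 0) (b := 1) (α := α) (β := fun s ↦ φ (z.1 * s) z.2)
    (fun s _ ↦ (hαd s).continuousAt.continuousWithinAt)
    (fun s hs ↦ by
      rw [hα s (Ico_subset_Icc_self hs)]
      exact (hαd s).hasDerivWithinAt)
    (fun s _ ↦ (hβd s).continuousAt.continuousWithinAt)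
    (fun s hs ↦ (hβd s).hasDerivWithinAt) (by simp [α, h0]) (x := 1) ⟨zero_le_one, le_rfl⟩
  rw [hα 1 ⟨zero_le_one, le_rfl⟩] at this
  simp only [mul_one] at this
  rw [← this]
  simp [ev]

theorem flow_add {f : F → F} (hf : ContDiff ℝ ∞ f) {φ : ℝ → F → F}
    (h0 : ∀ x, φ 0 x = x) (hφ : ∀ x t, HasDerivAt (fun s ↦ φ s x) (f (φ t x)) t) (s t : ℝ) (x : F) :
    φ (s + t) x = φ s (φ t x) := by
  refine eqOn_of_hasDerivAt hf (J := univ) ordConnected_univ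
    (α := fun s ↦ φ (s + t) x) (β := fun s ↦ φ s (φ t x)) (fun s _ ↦ ?_) (fun s _ ↦ hφ _ s)
    (mem_univ 0) (by simp [h0]) (mem_univ s)
  exact (hφ x (s + t)).comp_add_const s t

/-- Smoothness at small times propagates by φ s = φ (s - s₁) ∘ φ s₁. The order n is kept finite
because being C^n at a point is then an open condition, which can fail for n = ∞. -/
theorem contDiff_flow {f : F → F} (hf : ContDiff ℝ ∞ f) {φ : ℝ → F → F}
    (h0 : ∀ x, φ 0 x = x) (hφ : ∀ x t, HasDerivAt (fun s ↦ φ s x) (f (φ t x)) t) :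
    ContDiff ℝ ∞ (fun p : ℝ × F ↦ φ p.1 p.2) := by
  refine contDiff_infty.2 fun n ↦ ?_
  have hzero := fun x ↦ (contDiffAt_flow_zero hf h0 hφ x).of_le (show (n : WithTop ℕ∞) ≤ ∞ from mod_cast le_top)
  have hadd := flow_add hf h0 hφ
  have step : ∀ s₁ s x, ContDiffAt ℝ n (φ s₁) x →
      ContDiffAt ℝ n (fun p : ℝ × F ↦ φ p.1 p.2) (s - s₁, φ s₁ x) →
      ContDiffAt ℝ n (fun p : ℝ × F ↦ φ p.1 p.2) (s, x) := by
    intro s₁ s x h1 h2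
    have h3 : ContDiffAt ℝ n (fun p : ℝ × F ↦ (p.1 - s₁, φ s₁ p.2)) (s, x) :=
      (contDiffAt_fst.sub contDiffAt_const).prodMk (ContDiffAt.comp (s, x) h1 contDiffAt_snd)
    have h4 := ContDiffAt.comp (s, x) (g := fun p : ℝ × F ↦ φ p.1 p.2) h2 h3
    refine h4.congr_of_eventuallyEq (Eventually.of_forall fun p ↦ ?_)
    simp [← hadd]
  have slice : ∀ s x, ContDiffAt ℝ n (fun p : ℝ × F ↦ φ p.1 p.2) (s, x) →
      ContDiffAt ℝ n (φ s) x := fun s x h ↦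
    ContDiffAt.comp x (g := fun p : ℝ × F ↦ φ p.1 p.2) h (contDiffAt_const.prodMk contDiffAt_id)
  have hall : ∀ x s, ContDiffAt ℝ n (φ s) x := by
    intro x
    -- For s and s₁ near s₀, the pair (s - s₁, φ s₁ x) lies where the short-time flow is C^n. So
    -- regularity at one time near s₀ transfers to the others, giving openness of both the set and
    -- its complement.
    have hcl : IsClopen {s | ContDiffAt ℝ n (φ s) x} := by
      have key : ∀ s₀, ∀ᶠ s₁ in 𝓝 s₀, ∀ᶠ s in 𝓝 s₀,
          ContDiffAt ℝ n (fun p : ℝ × F ↦ φ p.1 p.2) (s - s₁, φ s₁ x) := by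
        intro s₀
        have h1 := (hzero (φ s₀ x)).eventually (by simp)
        have h2 : Tendsto (fun q : ℝ × ℝ ↦ (q.2 - q.1, φ q.1 x)) (𝓝 s₀ ×ˢ 𝓝 s₀)
            (𝓝 (0, φ s₀ x)) := by
          have : ContinuousAt (fun q : ℝ × ℝ ↦ (q.2 - q.1, φ q.1 x)) (s₀, s₀) :=
            (continuousAt_snd.sub continuousAt_fst).prodMk
              (ContinuousAt.comp (g := fun s ↦ φ s x) (hφ x s₀).continuousAt continuousAt_fst)
          rw [← nhds_prod_eq]
          simpa [ContinuousAt] using this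
        exact (h2.eventually h1).curry
      constructor
      · rw [← isOpen_compl_iff, isOpen_iff_mem_nhds]
        intro s₀ hs₀
        filter_upwards [key s₀] with s₁ hs₁ hmem
        exact hs₀ (slice _ _ (step s₁ s₀ x hmem hs₁.self_of_nhds))
      · rw [isOpen_iff_mem_nhds]
        intro s₀ hs₀
        filter_upwards [(key s₀).self_of_nhds] with s hs
        exact slice _ _ (step s₀ s x hs₀ hs)
    have := hcl.eq_univ ⟨0, by
      simpa [show φ 0 = id from funext h0] using contDiffAt_id⟩
    exact fun s ↦ (this.symm ▸ mem_univ s : s ∈ {s | ContDiffAt ℝ n (φ s) x})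
  rw [contDiff_iff_contDiffAt]
  rintro ⟨s, x⟩
  refine step s s x (hall x s) ?_
  rw [sub_self]
  exact hzero _

end Flow

/-! ### Flows all of whose points are poles: logarithm and convex balls -/

/-- The properties of the geodesic flow, in coordinates `(position, velocity)`, of a connection on
a vector space all of whose points are poles. -/
structure IsPoleFlow {E : Type*} [NormedAddCommGroup E] [NormedSpace ℝ E]
    (φ : ℝ → E × E → E × E) : Prop where
  contDiff : ContDiff ℝ ∞ fun p : ℝ × E × E ↦ φ p.1 p.2
  zero : ∀ p, φ 0 p = p
  add : ∀ s t p, φ (s + t) p = φ s (φ t p)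
  hasDerivAt : ∀ p t, HasDerivAt (fun s ↦ (φ s p).1) (φ t p).2 t
  smul : ∀ t c x v, φ t (x, c • v) = ((φ (c * t) (x, v)).1, c • (φ (c * t) (x, v)).2)
  bijective : ∀ x, Function.Bijective fun v ↦ (φ 1 (x, v)).1
  injective_fderiv : ∀ x v, Function.Injective (fderiv ℝ (fun v ↦ (φ 1 (x, v)).1) v)

namespace IsPoleFlow

section Log

variable {E : Type*} [NormedAddCommGroup E] [NormedSpace ℝ E]
  {φ : ℝ → E × E → E × E}

/-- The initial velocity of the geodesic from `x` to `y` parametrized by `[0, 1]`. -/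
def log (h : IsPoleFlow φ) (x y : E) : E := (Equiv.ofBijective _ (h.bijective x)).symm y

theorem exp_log (h : IsPoleFlow φ) (x y : E) : (φ 1 (x, h.log x y)).1 = y :=
  (Equiv.ofBijective _ (h.bijective x)).apply_symm_apply y

theorem log_exp (h : IsPoleFlow φ) (x v : E) : h.log x (φ 1 (x, v)).1 = v :=
  (Equiv.ofBijective _ (h.bijective x)).symm_apply_apply v

theorem exp_smul (h : IsPoleFlow φ) (t : ℝ) (x v : E) : (φ 1 (x, t • v)).1 = (φ t (x, v)).1 := by
  rw [h.smul, mul_one]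

theorem log_flow (h : IsPoleFlow φ) (t : ℝ) (x v : E) : h.log x (φ t (x, v)).1 = t • v := by
  rw [← h.exp_smul, log_exp]

theorem flow_zero_right (h : IsPoleFlow φ) (t : ℝ) (x : E) : φ t (x, 0) = (x, 0) := by
  have := h.smul t 0 x 0
  simpa [h.zero] using this

theorem log_self (h : IsPoleFlow φ) (x : E) : h.log x x = 0 := by
  have := h.log_flow 0 x 0
  rwa [h.zero, zero_smul] at this

theorem flow_neg_flow (h : IsPoleFlow φ) (t : ℝ) (p : E × E) : φ (-t) (φ t p) = p := by
  rw [← h.add, neg_add_cancel, h.zero]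

theorem flow_snd_ne_zero (h : IsPoleFlow φ) (t : ℝ) {p : E × E} (hp : p.2 ≠ 0) :
    (φ t p).2 ≠ 0 := by
  intro h0
  have h1 := h.flow_neg_flow t p
  rw [show φ t p = ((φ t p).1, 0) from Prod.ext rfl h0, h.flow_zero_right] at h1
  exact hp (by rw [← h1])

theorem continuous (h : IsPoleFlow φ) : Continuous fun p : ℝ × E × E ↦ φ p.1 p.2 :=
  h.contDiff.continuous

theorem contDiff_flow (h : IsPoleFlow φ) (t : ℝ) : ContDiff ℝ ∞ (φ t) :=
  h.contDiff.comp (contDiff_const.prodMk contDiff_id)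

variable [FiniteDimensional ℝ E]

/-- The map F is the identity in the first component, so its differential is block triangular with
diagonal blocks the identity and the derivative of exp_x. It is thus invertible, and global
injectivity of exp_x identifies the local inverse of F with (x, y) ↦ (x, log x y). -/
theorem contDiff_log (h : IsPoleFlow φ) : ContDiff ℝ ∞ fun p : E × E ↦ h.log p.1 p.2 := by
  have : CompleteSpace E := FiniteDimensional.complete ℝ E
  let F : E × E → E × E := fun p ↦ (p.1, (φ 1 p).1)
  have hF : ContDiff ℝ ∞ F := contDiff_fst.prodMk (contDiff_fst.comp (h.contDiff_flow 1))
  rw [contDiff_iff_contDiffAt]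
  rintro ⟨x, y⟩
  set v := h.log x y with hv
  have hFv : F (x, v) = (x, y) := Prod.ext rfl (h.exp_log x y)
  let D := fderiv ℝ F (x, v)
  have hD : HasFDerivAt F D (x, v) := (hF.differentiable (by simp) _).hasFDerivAt
  have hinj : Function.Injective D := by
    rw [injective_iff_map_eq_zero]
    rintro ⟨a, b⟩ hab
    have h1 : HasFDerivAt (fun p : E × E ↦ (F p).1) ((ContinuousLinearMap.fst ℝ E E).comp D)
      (x, v) := hasFDerivAt_fst.comp _ hD
    have h2 := h1.unique hasFDerivAt_fst
    have ha : a = 0 := by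
      have := DFunLike.congr_fun h2 (a, b)
      simpa [hab] using this.symm
    subst ha
    have h3 : HasFDerivAt (fun w ↦ (F (x, w)).2)
        ((ContinuousLinearMap.snd ℝ E E).comp (D.comp (.inr ℝ E E))) v :=
      hasFDerivAt_snd.comp v (hD.comp v (hasFDerivAt_prodMk_right x v))
    have hb : b = 0 := by
      refine (injective_iff_map_eq_zero _).1 (h.injective_fderiv x v) b ?_
      rw [show (fun v ↦ (φ 1 (x, v)).1) = fun w ↦ (F (x, w)).2 from rfl, h3.fderiv]
      simp [hab]
    rw [hb, Prod.mk_zero_zero]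
  let e : (E × E) ≃L[ℝ] (E × E) :=
    (LinearEquiv.ofInjectiveEndo D.toLinearMap hinj).toContinuousLinearEquiv
  have he : HasFDerivAt F (e : E × E →L[ℝ] E × E) (x, v) := by
    convert hD
    ext1 <;> rfl
  have hg := (hF.contDiffAt (x := (x, v))).to_localInverse he (by simp)
  have hev := (hF.contDiffAt.hasStrictFDerivAt' he (by simp)).eventually_right_inverse
  rw [hFv] at hg hev
  refine (contDiffAt_snd.comp _ hg).congr_of_eventuallyEq ?_
  filter_upwards [hev] with z hz
  set w := (hF.contDiffAt (x := (x, v))).localInverse he (by simp) z with hw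
  change h.log z.1 z.2 = w.2
  change F w = z at hz
  rw [← hz]
  exact h.log_exp w.1 w.2

/-- Geodesic segments with endpoints in a compact set stay in a compact set. -/
theorem exists_isCompact_segment (h : IsPoleFlow φ) {K : Set E} (hK : IsCompact K) :
    ∃ K', IsCompact K' ∧ ∀ x ∈ K, ∀ y ∈ K, ∀ t ∈ Icc (0 : ℝ) 1, (φ t (x, h.log x y)).1 ∈ K' := by
  refine ⟨(fun q : ℝ × E × E ↦ (φ q.1 (q.2.1, h.log q.2.1 q.2.2)).1) '' (Icc 0 1 ×ˢ K ×ˢ K),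
    (isCompact_Icc.prod (hK.prod hK)).image ?_, fun x hx y hy t ht ↦ ⟨(t, x, y), ⟨ht, hx, hy⟩, rfl⟩⟩
  exact continuous_fst.comp (h.continuous.comp (continuous_fst.prodMk
    ((continuous_fst.comp continuous_snd).prodMk (h.contDiff_log.continuous.comp continuous_snd))))

/-- Nonconstant geodesics leave compact sets. -/
theorem exists_flow_notMem (h : IsPoleFlow φ) {K : Set E} (hK : IsCompact K) {p : E × E}
    (hp : p.2 ≠ 0) : ∃ t : ℝ, 0 < t ∧ (φ t p).1 ∉ K := by
  have hc : Continuous (h.log p.1) := h.contDiff_log.continuous.comp (Continuous.prodMk_right p.1)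
  obtain ⟨R, hR⟩ := ((hK.image hc).isBounded).exists_norm_le
  have hp' : 0 < ‖p.2‖ := norm_pos_iff.2 hp
  -- The logarithm at time t is t • p.2; at this time its norm is |R| + 1, beyond the bound R valid
  -- on K.
  have hR' : 0 < (|R| + 1) / ‖p.2‖ := by positivity
  refine ⟨(|R| + 1) / ‖p.2‖, hR', fun hmem ↦ ?_⟩
  have := hR _ ⟨_, hmem, rfl⟩
  rw [show p = (p.1, p.2) from rfl, h.log_flow, norm_smul, Real.norm_of_nonneg hR'.le,
    div_mul_cancel₀ _ hp'.ne'] at this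
  linarith [le_abs_self R]

end Log

section Convex

variable {E : Type*} [NormedAddCommGroup E] [InnerProductSpace ℝ E]
  {φ : ℝ → E × E → E × E}

/-- The acceleration of the geodesic with given initial position and velocity. -/
def accel (φ : ℝ → E × E → E × E) (p : E × E) : E := deriv (fun s ↦ (φ s p).2) 0

theorem hasDerivAt_snd (h : IsPoleFlow φ) (p : E × E) (t : ℝ) :
    HasDerivAt (fun s ↦ (φ s p).2) (accel φ (φ t p)) t := by
  have hs : ContDiff ℝ ∞ fun s ↦ (φ s (φ t p)).2 :=
    contDiff_snd.comp (h.contDiff.comp (contDiff_id.prodMk contDiff_const))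
  have h1 : HasDerivAt (fun s ↦ (φ s (φ t p)).2) (accel φ (φ t p)) (t - t) := by
    rw [sub_self]
    exact (hs.differentiable (by simp) 0).hasDerivAt
  have h2 := h1.comp_sub_const t t
  refine h2.congr_of_eventuallyEq (Eventually.of_forall fun s ↦ ?_)
  simp [← h.add]

theorem continuous_accel (h : IsPoleFlow φ) : Continuous (accel φ) := by
  have hs : ContDiff ℝ ∞ fun q : (E × E) × ℝ ↦ (φ q.2 q.1).2 :=
    contDiff_snd.comp (h.contDiff.comp (contDiff_snd.prodMk contDiff_fst))
  have h1 : Continuous fun p : E × E ↦ fderiv ℝ (fun s ↦ (φ s p).2) 0 1 :=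
    ((hs.of_le (m := 1) (by simp)).fderiv_apply (n := 0) contDiff_const contDiff_const
      (by simp)).continuous
  exact h1

theorem accel_smul (h : IsPoleFlow φ) (c : ℝ) (x v : E) :
    accel φ (x, c • v) = (c * c) • accel φ (x, v) := by
  have h1 : (fun s ↦ (φ s (x, c • v)).2) = fun s ↦ c • (φ (c * s) (x, v)).2 := by
    ext1 s; rw [h.smul]
  have h2 : HasDerivAt (fun s ↦ (φ s (x, v)).2) (accel φ (x, v)) (c * 0) := by
    have := h.hasDerivAt_snd (x, v) 0
    rwa [h.zero, ← mul_zero c] at this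
  have h3 := (h2.scomp (0 : ℝ) ((hasDerivAt_id (0 : ℝ)).const_mul c)).const_smul c
  rw [accel, h1]
  refine h3.deriv.trans ?_
  simp [smul_smul]

variable [FiniteDimensional ℝ E]

/-- Compactness bounds the acceleration on unit vectors over K, and quadratic homogeneity extends
the bound to all vectors. -/
theorem exists_norm_accel_le (h : IsPoleFlow φ) {K : Set E} (hK : IsCompact K) :
    ∃ C : ℝ, 0 ≤ C ∧ ∀ x ∈ K, ∀ v, ‖accel φ (x, v)‖ ≤ C * ‖v‖ ^ 2 := by
  obtain ⟨C, hC⟩ := ((hK.prod (isCompact_sphere (0 : E) 1)).image h.continuous_accel).isBounded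
    |>.exists_norm_le
  refine ⟨|C|, abs_nonneg C, fun x hx v ↦ ?_⟩
  rcases eq_or_ne v 0 with rfl | hv
  · have := h.accel_smul 0 x 0
    simp only [zero_smul, mul_zero] at this
    simp [this]
  · have hv' : ‖v‖ ≠ 0 := norm_ne_zero_iff.2 hv
    have h1 := h.accel_smul ‖v‖ x (‖v‖⁻¹ • v)
    rw [smul_smul, mul_inv_cancel₀ hv', one_smul] at h1
    have h2 := hC _ ⟨(x, ‖v‖⁻¹ • v), ⟨hx, by simp [norm_smul, hv']⟩, rfl⟩
    rw [h1, norm_smul, Real.norm_of_nonneg (by positivity), ← pow_two, mul_comm]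
    gcongr
    exact h2.trans (le_abs_self C)

/-- The existence of arbitrarily small geodesically convex balls. -/
theorem exists_convex_ball (h : IsPoleFlow φ) (p : E) {V : Set E} (hV : V ∈ 𝓝 p) :
    ∃ ε > 0, Metric.closedBall p ε ⊆ V ∧ ∀ x ∈ Metric.ball p ε, ∀ y ∈ Metric.ball p ε,
      ∀ t ∈ Icc (0 : ℝ) 1, (φ t (x, h.log x y)).1 ∈ Metric.ball p ε := by
  obtain ⟨C, hC0, hC⟩ := h.exists_norm_accel_le (isCompact_closedBall p 1)
  -- This gives r ≤ 1, so that C applies within distance r of p, and C r ≤ 1, so that the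
  -- acceleration cannot spoil convexity.
  let r : ℝ := 1 / (C + 1)
  have hr : 0 < r := by positivity
  have hr1 : r ≤ 1 := (div_le_one (by positivity)).2 (by linarith)
  have hCr : C * r ≤ 1 := by
    rw [mul_one_div]
    exact (div_le_one (by positivity)).2 (by linarith)
  obtain ⟨δ₁, hδ₁, hδV⟩ := Metric.nhds_basis_closedBall.mem_iff.1 hV
  have hcont : Continuous fun q : (E × E) × ℝ ↦ (φ q.2 (q.1.1, h.log q.1.1 q.1.2)).1 :=
    continuous_fst.comp (h.continuous.comp (continuous_snd.prodMk
      ((continuous_fst.comp continuous_fst).prodMk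
        (h.contDiff_log.continuous.comp continuous_fst))))
  -- The segment from p to p is constant, so by compactness of [0, 1] segments with endpoints near p
  -- stay within r of p.
  have htube : ∀ᶠ q in 𝓝 (p, p), ∀ t ∈ Icc (0 : ℝ) 1,
      (φ t (q.1, h.log q.1 q.2)).1 ∈ Metric.ball p r := by
    refine isCompact_Icc.eventually_forall_of_forall_eventually fun t _ ↦ ?_
    refine hcont.continuousAt.eventually (Metric.isOpen_ball.mem_nhds ?_)
    simp [h.log_self, h.flow_zero_right, hr]
  obtain ⟨δ₂, hδ₂, hball⟩ := Metric.eventually_nhds_iff_ball.1 htube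
  refine ⟨min δ₁ (δ₂ / 2), by positivity,
    (Metric.closedBall_subset_closedBall (min_le_left _ _)).trans hδV, fun x hx y hy ↦ ?_⟩
  have hstay : ∀ t ∈ Icc (0 : ℝ) 1, (φ t (x, h.log x y)).1 ∈ Metric.ball p r := by
    refine hball (x, y) ?_
    rw [← ball_prod_same]
    have : min δ₁ (δ₂ / 2) ≤ δ₂ := (min_le_right _ _).trans (by linarith)
    exact ⟨Metric.ball_subset_ball this hx, Metric.ball_subset_ball this hy⟩
  set ε := min δ₁ (δ₂ / 2)
  set q : E × E := (x, h.log x y) with hq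
  let f : ℝ → ℝ := fun t ↦ ‖(φ t q).1 - p‖ ^ 2
  have hf' : ∀ t, HasDerivAt f (2 * inner ℝ ((φ t q).1 - p) (φ t q).2) t := fun t ↦
    ((h.hasDerivAt q t).sub_const p).norm_sq
  have hf'' : ∀ t, HasDerivAt (fun t ↦ 2 * inner ℝ ((φ t q).1 - p) (φ t q).2)
      (2 * (inner ℝ ((φ t q).1 - p) (accel φ (φ t q)) + inner ℝ (φ t q).2 (φ t q).2)) t := fun t ↦
    (((h.hasDerivAt q t).sub_const p).inner ℝ (h.hasDerivAt_snd q t)).const_mul 2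
  -- Half the second derivative is |y'|² + ⟨y - p, y''⟩ ≥ |y'|² - r C |y'|² ≥ 0. Convexity then
  -- bounds the distance to p by its values at the endpoints.
  have hconv : ConvexOn ℝ (Icc (0 : ℝ) 1) f := by
    refine convexOn_of_hasDerivWithinAt2_nonneg (convex_Icc 0 1)
      (fun t _ ↦ (hf' t).continuousAt.continuousWithinAt)
      (fun t _ ↦ (hf' t).hasDerivWithinAt) (fun t _ ↦ (hf'' t).hasDerivWithinAt) fun t ht ↦ ?_
    have ht' := hstay t (interior_subset ht)
    have h1 : ‖(φ t q).1 - p‖ ≤ r := (mem_ball_iff_norm.1 ht').le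
    have h2 := hC (φ t q).1 (Metric.closedBall_subset_closedBall hr1
      (Metric.ball_subset_closedBall ht')) (φ t q).2
    have h3 := (abs_le.1 (abs_real_inner_le_norm ((φ t q).1 - p) (accel φ (φ t q)))).1
    have h4 : ‖(φ t q).1 - p‖ * ‖accel φ (φ t q)‖ ≤ r * (C * ‖(φ t q).2‖ ^ 2) :=
      mul_le_mul h1 h2 (norm_nonneg _) hr.le
    have h5 : r * (C * ‖(φ t q).2‖ ^ 2) ≤ ‖(φ t q).2‖ ^ 2 := by
      rw [← mul_assoc, mul_comm r C]
      exact mul_le_of_le_one_left (by positivity) hCr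
    rw [real_inner_self_eq_norm_sq]
    linarith
  intro t ht
  have hmax := hconv.le_max_of_mem_Icc (x := 0) (y := 1) (z := t) ⟨le_rfl, zero_le_one⟩
    ⟨zero_le_one, le_rfl⟩ ht
  have hε : 0 < ε := by positivity
  have hlt : f t < ε ^ 2 := by
    refine hmax.trans_lt (max_lt ?_ ?_)
    · simp only [f, h.zero]
      exact pow_lt_pow_left₀ (mem_ball_iff_norm.1 hx) (norm_nonneg _) two_ne_zero
    · simp only [f, hq, h.exp_log]
      exact pow_lt_pow_left₀ (mem_ball_iff_norm.1 hy) (norm_nonneg _) two_ne_zero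
  exact mem_ball_iff_norm.2 (lt_of_pow_lt_pow_left₀ 2 hε.le hlt)

end Convex

end IsPoleFlow

/-! ### Orbits of the flow combined with scaling of velocities -/

section Orbit

variable {E : Type*} [NormedAddCommGroup E] [NormedSpace ℝ E]

/-- Flow for time `t`, then multiply the velocity by `c`. -/
def flowScale (φ : ℝ → E × E → E × E) (t c : ℝ) (p : E × E) : E × E :=
  ((φ t p).1, c • (φ t p).2)

/-- `q` is a multiple of a velocity vector of the geodesic with initial velocity `p`. -/
def OrbitRel (φ : ℝ → E × E → E × E) (p q : E × E) : Prop :=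
  ∃ t c : ℝ, c ≠ 0 ∧ q = flowScale φ t c p

variable {φ : ℝ → E × E → E × E}

namespace IsPoleFlow

/-- The parameters (t, c) with c ≠ 0 compose as affine maps of the line: scaling the velocity by c
multiplies subsequent time by c. -/
theorem flowScale_flowScale (h : IsPoleFlow φ) (s d t c : ℝ) (p : E × E) :
    flowScale φ s d (flowScale φ t c p) = flowScale φ (t + c * s) (d * c) p := by
  rw [flowScale, flowScale, h.smul, flowScale, add_comm t, h.add, smul_smul]

theorem flowScale_zero_one (h : IsPoleFlow φ) (p : E × E) : flowScale φ 0 1 p = p := by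
  simp [flowScale, h.zero]

theorem flowScale_inv (h : IsPoleFlow φ) (t : ℝ) {c : ℝ} (hc : c ≠ 0) (p : E × E) :
    flowScale φ (-t / c) c⁻¹ (flowScale φ t c p) = p := by
  rw [h.flowScale_flowScale, mul_div_cancel₀ _ hc, add_neg_cancel, inv_mul_cancel₀ hc,
    h.flowScale_zero_one]

theorem orbitRel_refl (h : IsPoleFlow φ) (p : E × E) : OrbitRel φ p p :=
  ⟨0, 1, one_ne_zero, (h.flowScale_zero_one p).symm⟩

theorem orbitRel_symm (h : IsPoleFlow φ) {p q : E × E} (hpq : OrbitRel φ p q) :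
    OrbitRel φ q p := by
  obtain ⟨t, c, hc, rfl⟩ := hpq
  exact ⟨_, _, inv_ne_zero hc, (h.flowScale_inv t hc p).symm⟩

theorem orbitRel_trans (h : IsPoleFlow φ) {p q r : E × E} (hpq : OrbitRel φ p q)
    (hqr : OrbitRel φ q r) : OrbitRel φ p r := by
  obtain ⟨t, c, hc, rfl⟩ := hpq
  obtain ⟨s, d, hd, rfl⟩ := hqr
  exact ⟨_, _, mul_ne_zero hd hc, h.flowScale_flowScale s d t c p⟩

theorem snd_ne_zero_of_orbitRel (h : IsPoleFlow φ) {p q : E × E} (hpq : OrbitRel φ p q)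
    (hp : p.2 ≠ 0) : q.2 ≠ 0 := by
  obtain ⟨t, c, hc, rfl⟩ := hpq
  exact smul_ne_zero hc (h.flow_snd_ne_zero t hp)

theorem contDiff_flowScale_uncurry (h : IsPoleFlow φ) :
    ContDiff ℝ ∞ fun z : (ℝ × ℝ) × E × E ↦ flowScale φ z.1.1 z.1.2 z.2 := by
  have h1 : ContDiff ℝ ∞ fun z : (ℝ × ℝ) × E × E ↦ φ z.1.1 z.2 :=
    h.contDiff.comp ((contDiff_fst.comp contDiff_fst).prodMk contDiff_snd)
  exact (contDiff_fst.comp h1).prodMk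
    ((contDiff_snd.comp contDiff_fst).smul (contDiff_snd.comp h1))

theorem contDiff_flowScale (h : IsPoleFlow φ) (t c : ℝ) : ContDiff ℝ ∞ (flowScale φ t c) :=
  h.contDiff_flowScale_uncurry.comp (f := fun p ↦ ((t, c), p)) (contDiff_const.prodMk contDiff_id)

/-- By symmetry of the relation the saturation is a union of preimages of O under continuous maps.
This is what makes the orbit projection open. -/
theorem isOpen_saturation (h : IsPoleFlow φ) {O : Set (E × E)} (hO : IsOpen O) :
    IsOpen {q | ∃ p ∈ O, OrbitRel φ p q} := by
  have : {q | ∃ p ∈ O, OrbitRel φ p q} =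
      ⋃ t : ℝ, ⋃ c : ℝ, ⋃ _ : c ≠ 0, flowScale φ t c ⁻¹' O := by
    ext q
    simp only [mem_ofPred_eq, mem_iUnion, mem_preimage]
    constructor
    · rintro ⟨p, hp, hpq⟩
      obtain ⟨t, c, hc, rfl⟩ := h.orbitRel_symm hpq
      exact ⟨t, c, hc, hp⟩
    · rintro ⟨t, c, hc, hm⟩
      exact ⟨_, hm, h.orbitRel_symm ⟨t, c, hc, rfl⟩⟩
  rw [this]
  exact isOpen_iUnion fun t ↦ isOpen_iUnion fun c ↦ isOpen_iUnion fun _ ↦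
    hO.preimage (h.contDiff_flowScale t c).continuous

end IsPoleFlow

/-- A local transversal to the orbits, parametrized by an open subset `dom` of `G`, together
with the projection along the orbits to the transversal. -/
structure Slice (φ : ℝ → E × E → E × E) (G : Type*) [NormedAddCommGroup G] [NormedSpace ℝ G] where
  dom : Set G
  isOpen_dom : IsOpen dom
  param : G → E × E
  contDiff_param : ContDiff ℝ ∞ param
  param_ne_zero : ∀ s ∈ dom, (param s).2 ≠ 0
  injOn_param : ∀ s ∈ dom, ∀ s' ∈ dom, OrbitRel φ (param s) (param s') → s = s'
  sat : Set (E × E)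
  isOpen_sat : IsOpen sat
  mem_sat_iff : ∀ q, q ∈ sat ↔ ∃ s ∈ dom, OrbitRel φ (param s) q
  retr : E × E → G
  contDiffOn_retr : ContDiffOn ℝ ∞ retr sat
  retr_mem : ∀ q ∈ sat, retr q ∈ dom
  orbitRel_retr : ∀ q ∈ sat, OrbitRel φ (param (retr q)) q

end Orbit

/-! ### Closedness of the orbit relation and existence of slices -/

section Exists

variable {E : Type*} [NormedAddCommGroup E] [InnerProductSpace ℝ E]
  {φ : ℝ → E × E → E × E}

namespace IsPoleFlow

/-- The left side is defined for every vector in place of t • v. Orbit parameters thus extend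
continuously to pairs not in the same orbit, as the proof of closedness requires. -/
theorem inner_smul_div_norm_sq {v : E} (hv : v ≠ 0) (t : ℝ) :
    inner ℝ (t • v) v / ‖v‖ ^ 2 = t := by
  rw [real_inner_smul_left, real_inner_self_eq_norm_sq, mul_div_cancel_right₀]
  simpa using hv

/-- The time at which the geodesic with initial velocity `p` passes through the base point of a
vector `q` in the orbit of `p`. -/
def orbitTime (h : IsPoleFlow φ) (p q : E × E) : ℝ := inner ℝ (h.log p.1 q.1) p.2 / ‖p.2‖ ^ 2

/-- The factor between a vector `q` in the orbit of `p` and the velocity of the geodesic. -/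
def orbitScale (h : IsPoleFlow φ) (p q : E × E) : ℝ :=
  inner ℝ q.2 (φ (h.orbitTime p q) p).2 / ‖(φ (h.orbitTime p q) p).2‖ ^ 2

/-- Since `log` of the position at time t is t • p.2, the position alone determines the time: a
nonconstant geodesic has no self-intersection. -/
theorem orbitTime_flowScale (h : IsPoleFlow φ) {p : E × E} (hp : p.2 ≠ 0) (t c : ℝ) :
    h.orbitTime p (flowScale φ t c p) = t := by
  have := h.log_flow t p.1 p.2
  rw [orbitTime, show (flowScale φ t c p).1 = (φ t (p.1, p.2)).1 from rfl, this,
    inner_smul_div_norm_sq hp]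

theorem orbitScale_flowScale (h : IsPoleFlow φ) {p : E × E} (hp : p.2 ≠ 0) (t c : ℝ) :
    h.orbitScale p (flowScale φ t c p) = c := by
  rw [orbitScale, h.orbitTime_flowScale hp]
  exact inner_smul_div_norm_sq (h.flow_snd_ne_zero t hp) c

variable [FiniteDimensional ℝ E]

/-- A linear complement to the tangent space of an orbit. -/
theorem exists_complement {v : E} (hv : v ≠ 0) (a : E) {k : ℕ}
    (hk : k = 2 * Module.finrank ℝ E - 2) :
    ∃ ι : Model k →L[ℝ] E × E, ∀ (τ c : ℝ) (s : Model k),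
      τ • (v, a) + c • ((0 : E), v) + ι s = 0 → τ = 0 ∧ c = 0 ∧ s = 0 := by
  -- When a is the acceleration, the vectors (v, a) and (0, v) are the derivatives of `flowScale` in
  -- t and in c at (0, 1). They are independent because v ≠ 0.
  let D : ℝ × ℝ →ₗ[ℝ] E × E :=
    (LinearMap.toSpanSingleton ℝ (E × E) (v, a)).coprod
      (LinearMap.toSpanSingleton ℝ (E × E) (0, v))
  have hD : ∀ τ c, D (τ, c) = τ • (v, a) + c • ((0 : E), v) := fun τ c ↦ by simp [D]
  have hDinj : ∀ τ c, D (τ, c) = 0 → τ = 0 ∧ c = 0 := by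
    intro τ c h0
    rw [hD] at h0
    have h1 := congrArg Prod.fst h0
    have h2 := congrArg Prod.snd h0
    simp only [Prod.fst_add, Prod.smul_fst, smul_zero, add_zero, Prod.fst_zero, Prod.snd_add,
      Prod.smul_snd, Prod.snd_zero, smul_eq_zero, hv, or_false] at h1 h2
    subst h1
    simpa [hv] using h2
  have hinj : Function.Injective D := by
    rw [injective_iff_map_eq_zero]
    rintro ⟨τ, c⟩ h0
    exact Prod.ext (hDinj τ c h0).1 (hDinj τ c h0).2
  obtain ⟨C, hC⟩ := Submodule.exists_isCompl (LinearMap.range D)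
  have hrank : Module.finrank ℝ (Model k) = Module.finrank ℝ C := by
    have h1 := Submodule.finrank_add_eq_of_isCompl hC
    rw [LinearMap.finrank_range_of_inj hinj, Module.finrank_prod, Module.finrank_prod,
      Module.finrank_self] at h1
    rw [finrank_euclideanSpace_fin]
    omega
  let e : Model k ≃L[ℝ] C := ContinuousLinearEquiv.ofFinrankEq hrank
  refine ⟨C.subtypeL.comp e.toContinuousLinearMap, fun τ c s h0 ↦ ?_⟩
  rw [← hD] at h0
  have h1 : D (τ, c) = -(e s : E × E) := eq_neg_of_add_eq_zero_left h0
  have h2 : D (τ, c) = 0 :=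
    Submodule.disjoint_def.1 hC.disjoint _ ⟨_, rfl⟩ (h1 ▸ C.neg_mem (e s).2)
  obtain ⟨h3, h4⟩ := hDinj τ c h2
  refine ⟨h3, h4, ?_⟩
  rw [h2, eq_comm, neg_eq_zero, ZeroMemClass.coe_eq_zero, ContinuousLinearEquiv.map_eq_zero_iff]
    at h1
  exact h1

theorem continuousAt_orbitTime (h : IsPoleFlow φ) {p q : E × E} (hp : p.2 ≠ 0) :
    ContinuousAt (fun z : (E × E) × (E × E) ↦ h.orbitTime z.1 z.2) (p, q) := by
  have h1 : Continuous fun z : (E × E) × (E × E) ↦ h.log z.1.1 z.2.1 :=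
    h.contDiff_log.continuous.comp ((continuous_fst.comp continuous_fst).prodMk
      (continuous_fst.comp continuous_snd))
  have h2 : Continuous fun z : (E × E) × (E × E) ↦ z.1.2 := continuous_snd.comp continuous_fst
  exact (h1.inner h2).continuousAt.div (h2.norm.pow 2).continuousAt (by simpa using hp)

theorem continuousAt_orbitScale (h : IsPoleFlow φ) {p q : E × E} (hp : p.2 ≠ 0) :
    ContinuousAt (fun z : (E × E) × (E × E) ↦ h.orbitScale z.1 z.2) (p, q) := by
  have h1 : ContinuousAt (fun z : (E × E) × (E × E) ↦ (φ (h.orbitTime z.1 z.2) z.1).2) (p, q) :=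
    ContinuousAt.comp (g := fun w : ℝ × (E × E) ↦ (φ w.1 w.2).2)
      (continuous_snd.comp h.continuous).continuousAt
      ((h.continuousAt_orbitTime hp).prodMk continuousAt_fst)
  have h2 : Continuous fun z : (E × E) × (E × E) ↦ z.2.2 := continuous_snd.comp continuous_snd
  exact (h2.continuousAt.inner h1).div (h1.norm.pow 2)
    (by simpa using h.flow_snd_ne_zero _ hp)

/-- The recovered parameters are continuous in the pair of vectors and equal (0, 1) at (p₀, p₀). So
an orbit passing near p₀ comes near it again only for parameters near (0, 1). -/
theorem eventually_small (h : IsPoleFlow φ) {p₀ : E × E} (hp₀ : p₀.2 ≠ 0) {ε : ℝ} (hε : 0 < ε) :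
    ∀ᶠ z : (E × E) × (E × E) in 𝓝 (p₀, p₀), ∀ t c : ℝ, z.2 = flowScale φ t c z.1 →
      |t| < ε ∧ |c - 1| < ε := by
  have ht := h.orbitTime_flowScale hp₀ 0 1
  have hc := h.orbitScale_flowScale hp₀ 0 1
  rw [h.flowScale_zero_one] at ht hc
  have hev : ∀ᶠ z : (E × E) × (E × E) in 𝓝 (p₀, p₀), |h.orbitTime z.1 z.2| < ε :=
    (h.continuousAt_orbitTime hp₀).abs.eventually_lt continuousAt_const (by simpa [ht] using hε)
  have hev1 : ∀ᶠ z : (E × E) × (E × E) in 𝓝 (p₀, p₀), |h.orbitScale z.1 z.2 - 1| < ε :=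
    ((h.continuousAt_orbitScale hp₀).sub continuousAt_const).abs.eventually_lt
      continuousAt_const (by simpa [hc] using hε)
  have hev2 : ∀ᶠ z : (E × E) × (E × E) in 𝓝 (p₀, p₀), z.1.2 ≠ 0 :=
    (continuous_snd.comp continuous_fst).continuousAt.eventually_ne hp₀
  filter_upwards [hev, hev1, hev2] with z hz hz1 hz2 t c hzc
  rw [hzc, h.orbitTime_flowScale hz2] at hz
  rw [hzc, h.orbitScale_flowScale hz2] at hz1
  exact ⟨hz, hz1⟩

/-- The orbit relation is closed. -/
theorem eventually_not_orbitRel (h : IsPoleFlow φ) {p q : E × E} (hp : p.2 ≠ 0) (hq : q.2 ≠ 0)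
    (hpq : ¬ OrbitRel φ p q) :
    ∀ᶠ z : (E × E) × (E × E) in 𝓝 (p, q), ¬ OrbitRel φ z.1 z.2 := by
  have hev2 : ∀ᶠ z : (E × E) × (E × E) in 𝓝 (p, q), z.1.2 ≠ 0 :=
    (continuous_snd.comp continuous_fst).continuousAt.eventually_ne hp
  have hcont : ContinuousAt (fun z : (E × E) × (E × E) ↦
      flowScale φ (h.orbitTime z.1 z.2) (h.orbitScale z.1 z.2) z.1) (p, q) :=
    ContinuousAt.comp (g := fun w : (ℝ × ℝ) × E × E ↦ flowScale φ w.1.1 w.1.2 w.2)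
      h.contDiff_flowScale_uncurry.continuous.continuousAt
      (((h.continuousAt_orbitTime hp).prodMk (h.continuousAt_orbitScale hp)).prodMk
        continuousAt_fst)
  -- Being in the same orbit forces q to equal its reconstruction from the recovered parameters;
  -- conversely such an equality gives the relation, the scale being nonzero because q.2 ≠ 0. Hence
  -- failure of the equation, an open condition, detects unrelated pairs.
  have hne : q ≠ flowScale φ (h.orbitTime p q) (h.orbitScale p q) p := fun heq ↦ by
    refine hpq ⟨_, _, fun h0 ↦ hq ?_, heq⟩
    rw [heq, h0, flowScale, zero_smul]
  have hev : ∀ᶠ z : (E × E) × (E × E) in 𝓝 (p, q),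
      z.2 ≠ flowScale φ (h.orbitTime z.1 z.2) (h.orbitScale z.1 z.2) z.1 :=
    (continuousAt_snd.prodMk hcont).eventually_mem
      ((isOpen_ne_fun continuous_fst continuous_snd).mem_nhds hne)
  filter_upwards [hev, hev2] with z hz hz2
  rintro ⟨t, c, -, hzc⟩
  refine hz ?_
  conv_rhs => rw [hzc, h.orbitTime_flowScale hz2, h.orbitScale_flowScale hz2]
  exact hzc

/-- Take an affine transversal σ through p₀ complementary to the orbit. Then Θ (t, c, s) =
`flowScale` t c (σ s) is a local diffeomorphism at (0, 1, 0), and `eventually_small` upgrades local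
injectivity to at most one point of the small transversal per orbit. Elsewhere in the saturation,
smoothness of the retraction is transported from the transversal along the orbit. -/
theorem exists_slice (h : IsPoleFlow φ) {p₀ : E × E} (hp₀ : p₀.2 ≠ 0) {k : ℕ}
    (hk : k = 2 * Module.finrank ℝ E - 2) :
    ∃ S : Slice φ (Model k), ∃ s ∈ S.dom, S.param s = p₀ := by
  have : CompleteSpace E := FiniteDimensional.complete ℝ E
  obtain ⟨ι, hι⟩ := exists_complement hp₀ (accel φ p₀) hk
  let σ : Model k → E × E := fun s ↦ p₀ + ι s
  have hσ : ContDiff ℝ ∞ σ := contDiff_const.add ι.contDiff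
  have hσ0 : σ 0 = p₀ := by simp [σ]
  let Θ : (ℝ × ℝ) × Model k → E × E := fun z ↦ flowScale φ z.1.1 z.1.2 (σ z.2)
  have hΘ : ContDiff ℝ ∞ Θ :=
    h.contDiff_flowScale_uncurry.comp (contDiff_fst.prodMk (hσ.comp contDiff_snd))
  have hΘ1 : ∀ s, Θ ((0, 1), s) = σ s := fun s ↦ h.flowScale_zero_one _
  let z₀ : (ℝ × ℝ) × Model k := ((0, 1), 0)
  let A := fderiv ℝ Θ z₀
  have hA : HasFDerivAt Θ A z₀ := (hΘ.differentiable (by simp) _).hasFDerivAt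
  have hA1 : A ((1, 0), 0) = (p₀.2, accel φ p₀) := by
    have h1 : HasDerivAt (fun t : ℝ ↦ ((t, (1 : ℝ)), (0 : Model k))) ((1, 0), 0) 0 :=
      ((hasDerivAt_id (0 : ℝ)).prodMk (hasDerivAt_const (0 : ℝ) (1 : ℝ))).prodMk
        (hasDerivAt_const (0 : ℝ) (0 : Model k))
    have h2 := hA.comp_hasDerivAt (0 : ℝ) h1
    have h3 : HasDerivAt (fun t ↦ φ t p₀) (p₀.2, accel φ p₀) 0 := by
      have := (h.hasDerivAt p₀ 0).prodMk (h.hasDerivAt_snd p₀ 0)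
      simpa [h.zero] using this
    refine h2.unique (h3.congr_of_eventuallyEq (Eventually.of_forall fun t ↦ ?_))
    simp [Θ, flowScale, hσ0]
  have hA2 : A ((0, 1), 0) = (0, p₀.2) := by
    have h1 : HasDerivAt (fun c : ℝ ↦ (((0 : ℝ), c), (0 : Model k))) ((0, 1), 0) 1 :=
      ((hasDerivAt_const (1 : ℝ) (0 : ℝ)).prodMk (hasDerivAt_id (1 : ℝ))).prodMk
        (hasDerivAt_const (1 : ℝ) (0 : Model k))
    have h2 := hA.comp_hasDerivAt (1 : ℝ) h1
    have h3 : HasDerivAt (fun c : ℝ ↦ (p₀.1, c • p₀.2)) (0, p₀.2) 1 := by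
      have := (hasDerivAt_const (1 : ℝ) p₀.1).prodMk ((hasDerivAt_id (1 : ℝ)).smul_const p₀.2)
      simpa using this
    refine h2.unique (h3.congr_of_eventuallyEq (Eventually.of_forall fun t ↦ ?_))
    simp [Θ, flowScale, hσ0, h.zero]
  have hA3 : ∀ s, A ((0, 0), s) = ι s := by
    have h2 : HasFDerivAt (fun s ↦ Θ ((0, 1), s)) (A.comp (.inr ℝ (ℝ × ℝ) (Model k))) 0 :=
      hA.comp (0 : Model k) (hasFDerivAt_prodMk_right _ _)
    have h3 : HasFDerivAt (fun s ↦ Θ ((0, 1), s)) ι 0 := by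
      simp_rw [hΘ1]
      exact ι.hasFDerivAt.const_add p₀
    intro s
    exact DFunLike.congr_fun (h2.unique h3) s
  have hAinj : Function.Injective A := by
    rw [injective_iff_map_eq_zero]
    rintro ⟨⟨τ, c⟩, s⟩ h0
    have h1 : (((τ, c), s) : (ℝ × ℝ) × Model k) =
        τ • ((1, 0), 0) + c • ((0, 1), 0) + ((0, 0), s) := by simp
    rw [h1, map_add, map_add, map_smul, map_smul, hA1, hA2, hA3] at h0
    obtain ⟨rfl, rfl, rfl⟩ := hι τ c s h0
    rfl
  -- Subtraction is truncated, so 2 + (2d - 2) = 2d needs d > 0; the nonzero vector p₀.2 provides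
  -- this.
  have hrank : Module.finrank ℝ ((ℝ × ℝ) × Model k) = Module.finrank ℝ (E × E) := by
    have : 0 < Module.finrank ℝ E := Module.finrank_pos_iff_exists_ne_zero.2 ⟨_, hp₀⟩
    simp only [Module.finrank_prod, Module.finrank_self, finrank_euclideanSpace_fin]
    omega
  let e : ((ℝ × ℝ) × Model k) ≃L[ℝ] (E × E) :=
    (LinearMap.linearEquivOfInjective A.toLinearMap hAinj hrank).toContinuousLinearEquiv
  have he : HasFDerivAt Θ (e : (ℝ × ℝ) × Model k →L[ℝ] E × E) z₀ := by
    convert hA using 1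
    exact ContinuousLinearMap.ext fun _ ↦ rfl
  let T := (hΘ.contDiffAt (x := z₀)).toOpenPartialHomeomorph Θ he (by simp)
  -- On O the derivative stays invertible, so the inverse is smooth at every point of Θ(O), not only
  -- at Θ z₀.
  let O : Set ((ℝ × ℝ) × Model k) := T.source ∩
    fderiv ℝ Θ ⁻¹' range ((↑) : (((ℝ × ℝ) × Model k) ≃L[ℝ] (E × E)) → _)
  have hO : IsOpen O := T.open_source.inter
    ((ContinuousLinearEquiv.isOpen (𝕜 := ℝ)).preimage (hΘ.continuous_fderiv (by simp)))
  have hz₀O : z₀ ∈ O := ⟨ContDiffAt.mem_toOpenPartialHomeomorph_source _ he _, ⟨e, he.fderiv.symm⟩⟩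
  have hTsymm : ∀ z ∈ O, ContDiffAt ℝ ∞ T.symm (Θ z) := by
    rintro z ⟨hz, ⟨e', he'⟩⟩
    have hl : T.symm (Θ z) = z := T.left_inv hz
    refine T.contDiffAt_symm (T.map_source hz) (f₀' := e') ?_ hΘ.contDiffAt
    rw [hl, he']
    exact (hΘ.differentiable (by simp) z).hasFDerivAt
  obtain ⟨ε, hε, hεO⟩ := Metric.mem_nhds_iff.1 (hO.mem_nhds hz₀O)
  have hbox : ∀ (t c : ℝ) (s : Model k), |t| < ε → |c - 1| < ε → ‖s‖ < ε → ((t, c), s) ∈ O := by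
    intro t c s ht hc hs
    refine hεO ?_
    rw [mem_ball_iff_norm]
    simpa [z₀, Prod.norm_def] using ⟨⟨ht, hc⟩, hs⟩
  have hσσ : ContinuousAt (fun z : Model k × Model k ↦ (σ z.1, σ z.2)) (0, 0) :=
    ((hσ.continuous.comp continuous_fst).prodMk
      (hσ.continuous.comp continuous_snd)).continuousAt
  have hev := hσσ.eventually (by simpa only [hσ0] using h.eventually_small hp₀ hε)
  have hev2 : ∀ᶠ z : Model k × Model k in 𝓝 (0, 0), (σ z.1).2 ≠ 0 :=
    (continuous_snd.comp (hσ.continuous.comp continuous_fst)).continuousAt.eventually_ne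
      (by simpa [hσ0] using hp₀)
  obtain ⟨δ₀, hδ₀, hδ₀ball⟩ := Metric.eventually_nhds_iff_ball.1 (hev.and hev2)
  let δ := min δ₀ ε
  have hδ : 0 < δ := lt_min hδ₀ hε
  let B : Set (Model k) := Metric.ball 0 δ
  have hB : ∀ s ∈ B, ∀ s' ∈ B, (∀ t c : ℝ, σ s' = flowScale φ t c (σ s) → |t| < ε ∧ |c - 1| < ε) ∧
      (σ s).2 ≠ 0 := fun s hs s' hs' ↦ hδ₀ball (s, s') (by
    rw [← ball_prod_same]
    exact ⟨Metric.ball_subset_ball (min_le_left _ _) hs,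
      Metric.ball_subset_ball (min_le_left _ _) hs'⟩)
  have hBε : ∀ s ∈ B, ‖s‖ < ε := fun s hs ↦ (mem_ball_zero_iff.1 hs).trans_le (min_le_right _ _)
  have h01 : ∀ s ∈ B, (((0, 1), s) : (ℝ × ℝ) × Model k) ∈ O := fun s hs ↦
    hbox 0 1 s (by simpa using hε) (by simpa using hε) (hBε s hs)
  have hinj : ∀ s ∈ B, ∀ s' ∈ B, OrbitRel φ (σ s) (σ s') → s = s' := by
    rintro s hs s' hs' ⟨t, c, hc, hst⟩
    obtain ⟨ht, hc1⟩ := (hB s hs s' hs').1 t c hst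
    -- Both parameter triples lie in the box where Θ is injective, so their slice coordinates agree.
    have h1 : Θ ((t, c), s) = Θ ((0, 1), s') := by rw [hΘ1]; exact hst.symm
    have h2 := T.injOn (hbox t c s ht hc1 (hBε s hs)).1 (h01 s' hs').1 h1
    exact congrArg Prod.snd h2
  -- Nothing in O excludes c = 0, so this is imposed here to make every point of W lie in the orbit
  -- of a slice point.
  let O' : Set ((ℝ × ℝ) × Model k) := O ∩ ({z | z.1.2 ≠ 0} ∩ {z | z.2 ∈ B})
  have hO' : IsOpen O' := hO.inter ((isOpen_ne_fun (by fun_prop) (by fun_prop)).inter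
    (Metric.isOpen_ball.preimage continuous_snd))
  let W : Set (E × E) := Θ '' O'
  have hW : IsOpen W := T.isOpen_image_of_subset_source hO' fun z hz ↦ hz.1.1
  have hσW : ∀ s ∈ B, σ s ∈ W := fun s hs ↦ ⟨((0, 1), s), ⟨h01 s hs, one_ne_zero, hs⟩, hΘ1 s⟩
  let U : Set (E × E) := {q | ∃ s ∈ B, OrbitRel φ (σ s) q}
  have hU : IsOpen U := by
    convert h.isOpen_saturation hW using 1
    ext q
    constructor
    · rintro ⟨s, hs, hsq⟩
      exact ⟨σ s, hσW s hs, hsq⟩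
    · rintro ⟨_, ⟨z, hz, rfl⟩, hzq⟩
      exact ⟨z.2, hz.2.2, h.orbitRel_trans ⟨z.1.1, z.1.2, hz.2.1, rfl⟩ hzq⟩
  classical
  let ρ : E × E → Model k := fun q ↦ if hq : q ∈ U then hq.choose else 0
  have hρ : ∀ q (hq : q ∈ U), ρ q ∈ B ∧ OrbitRel φ (σ (ρ q)) q := by
    intro q hq
    simp only [ρ, dif_pos hq]
    exact hq.choose_spec
  refine ⟨⟨B, Metric.isOpen_ball, σ, hσ, fun s hs ↦ (hB s hs s hs).2, hinj, U, hU,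
    fun q ↦ Iff.rfl, ρ, fun q hq ↦ ContDiffAt.contDiffWithinAt ?_, fun q hq ↦ (hρ q hq).1,
    fun q hq ↦ (hρ q hq).2⟩, 0, Metric.mem_ball_self hδ, hσ0⟩
  obtain ⟨s, hs, t, c, hc, rfl⟩ := hq
  -- Points near `flowScale` t c (σ s) are moved back along their orbits to points near σ s. There
  -- the smooth inverse of Θ yields a slice coordinate, and by `hinj` it is the chosen value of ρ.
  have hg : flowScale φ (-t / c) c⁻¹ (flowScale φ t c (σ s)) = Θ ((0, 1), s) := by
    rw [h.flowScale_inv t hc, hΘ1]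
  have h1 : ContDiffAt ℝ ∞ (fun q ↦ (T.symm (flowScale φ (-t / c) c⁻¹ q)).2)
      (flowScale φ t c (σ s)) := by
    refine contDiffAt_snd.comp _ (ContDiffAt.comp _ ?_ (h.contDiff_flowScale _ _).contDiffAt)
    rw [hg]
    exact hTsymm _ (h01 s hs)
  refine h1.congr_of_eventuallyEq ?_
  have h2 : ∀ᶠ q in 𝓝 (flowScale φ t c (σ s)), flowScale φ (-t / c) c⁻¹ q ∈ W :=
    (h.contDiff_flowScale _ _).continuous.continuousAt.eventually_mem
      (hW.mem_nhds (by rw [hg, hΘ1]; exact hσW s hs))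
  filter_upwards [h2] with q hq
  obtain ⟨z, hz, hzq⟩ := hq
  have h3 : T.symm (flowScale φ (-t / c) c⁻¹ q) = z := by
    rw [← hzq]
    exact T.left_inv hz.1.1
  have h4 : OrbitRel φ (σ z.2) q :=
    h.orbitRel_trans ⟨z.1.1, z.1.2, hz.2.1, hzq.symm⟩
      (h.orbitRel_symm ⟨-t / c, c⁻¹, inv_ne_zero hc, rfl⟩)
  have h5 := hρ q ⟨z.2, hz.2.2, h4⟩
  rw [h3]
  exact hinj _ h5.1 _ hz.2.2 (h.orbitRel_trans h5.2 (h.orbitRel_symm h4))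

end IsPoleFlow

end Exists

/-! ### The orbit space as a manifold -/

/-- `pr` exhibits `Q` as the topological quotient of the nonzero vectors by the orbit relation. -/
structure IsOrbitMap {E Q : Type*} [NormedAddCommGroup E] [NormedSpace ℝ E] [TopologicalSpace Q]
    (φ : ℝ → E × E → E × E) (pr : E × E → Q) : Prop where
  surj : ∀ q, ∃ p : E × E, p.2 ≠ 0 ∧ pr p = q
  isOpen_iff : ∀ W : Set Q, IsOpen W ↔ IsOpen {p : E × E | p.2 ≠ 0 ∧ pr p ∈ W}
  eq_iff : ∀ p q : E × E, p.2 ≠ 0 → q.2 ≠ 0 → (pr p = pr q ↔ OrbitRel φ p q)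

namespace IsOrbitMap

section Topology

variable {E Q : Type*} [NormedAddCommGroup E] [NormedSpace ℝ E] [TopologicalSpace Q]
  {φ : ℝ → E × E → E × E} {pr : E × E → Q}

theorem isOpen_ne {E : Type*} [NormedAddCommGroup E] : IsOpen {p : E × E | p.2 ≠ 0} :=
  isOpen_ne_fun continuous_snd continuous_const

theorem continuousOn (hpr : IsOrbitMap φ pr) : ContinuousOn pr {p | p.2 ≠ 0} := by
  rw [continuousOn_open_iff isOpen_ne]
  exact fun W hW ↦ (hpr.isOpen_iff W).1 hW

theorem isOpen_image (h : IsPoleFlow φ) (hpr : IsOrbitMap φ pr) {O : Set (E × E)} (hO : IsOpen O)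
    (hO0 : ∀ p ∈ O, p.2 ≠ 0) : IsOpen (pr '' O) := by
  rw [hpr.isOpen_iff]
  convert h.isOpen_saturation hO using 1
  ext q
  constructor
  · rintro ⟨hq, p, hp, hpq⟩
    exact ⟨p, hp, (hpr.eq_iff p q (hO0 p hp) hq).1 hpq⟩
  · rintro ⟨p, hp, hpq⟩
    have hq := h.snd_ne_zero_of_orbitRel hpq (hO0 p hp)
    exact ⟨hq, p, hp, (hpr.eq_iff p q (hO0 p hp) hq).2 hpq⟩

theorem isOpenQuotientMap (h : IsPoleFlow φ) (hpr : IsOrbitMap φ pr) :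
    IsOpenQuotientMap fun p : {p : E × E // p.2 ≠ 0} ↦ pr p where
  surjective q := by
    obtain ⟨p, hp, rfl⟩ := hpr.surj q
    exact ⟨⟨p, hp⟩, rfl⟩
  continuous := continuousOn_iff_continuous_domRestrict.1 hpr.continuousOn
  isOpenMap O hO := by
    have := hpr.isOpen_image h (isOpen_ne.isOpenMap_subtype_val O hO) (by
      rintro _ ⟨p, -, rfl⟩
      exact p.2)
    rwa [image_image] at this

/-- A representative of a point of the orbit space. -/
def rep (hpr : IsOrbitMap φ pr) (q : Q) : E × E := (hpr.surj q).choose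

theorem rep_ne_zero (hpr : IsOrbitMap φ pr) (q : Q) : (hpr.rep q).2 ≠ 0 :=
  (hpr.surj q).choose_spec.1

theorem apply_rep (hpr : IsOrbitMap φ pr) (q : Q) : pr (hpr.rep q) = q :=
  (hpr.surj q).choose_spec.2

end Topology

end IsOrbitMap

section SliceLemmas

variable {E Q G : Type*} [NormedAddCommGroup E] [NormedSpace ℝ E] [TopologicalSpace Q]
  [NormedAddCommGroup G] [NormedSpace ℝ G]
  {φ : ℝ → E × E → E × E} {pr : E × E → Q}

namespace Slice

theorem ne_zero_of_mem_sat (h : IsPoleFlow φ) (S : Slice φ G) {p : E × E} (hp : p ∈ S.sat) :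
    p.2 ≠ 0 := by
  obtain ⟨s, hs, hsp⟩ := (S.mem_sat_iff p).1 hp
  exact h.snd_ne_zero_of_orbitRel hsp (S.param_ne_zero s hs)

theorem mem_sat_of_orbitRel (h : IsPoleFlow φ) (S : Slice φ G) {p q : E × E} (hp : p ∈ S.sat)
    (hpq : OrbitRel φ p q) : q ∈ S.sat := by
  obtain ⟨s, hs, hsp⟩ := (S.mem_sat_iff p).1 hp
  exact (S.mem_sat_iff q).2 ⟨s, hs, h.orbitRel_trans hsp hpq⟩

theorem retr_eq_of_orbitRel (h : IsPoleFlow φ) (S : Slice φ G) {p q : E × E} (hp : p ∈ S.sat)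
    (hpq : OrbitRel φ p q) : S.retr p = S.retr q := by
  have hq := S.mem_sat_of_orbitRel h hp hpq
  exact S.injOn_param _ (S.retr_mem p hp) _ (S.retr_mem q hq)
    (h.orbitRel_trans (S.orbitRel_retr p hp)
      (h.orbitRel_trans hpq (h.orbitRel_symm (S.orbitRel_retr q hq))))

theorem param_mem_sat (h : IsPoleFlow φ) (S : Slice φ G) {s : G} (hs : s ∈ S.dom) :
    S.param s ∈ S.sat := (S.mem_sat_iff _).2 ⟨s, hs, h.orbitRel_refl _⟩

theorem retr_param (h : IsPoleFlow φ) (S : Slice φ G) {s : G} (hs : s ∈ S.dom) :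
    S.retr (S.param s) = s :=
  have hm := S.param_mem_sat h hs
  S.injOn_param _ (S.retr_mem _ hm) _ hs (S.orbitRel_retr _ hm)

theorem mem_sat_iff_apply_mem (h : IsPoleFlow φ) (hpr : IsOrbitMap φ pr) (S : Slice φ G) {p : E × E}
    (hp : p.2 ≠ 0) : pr p ∈ pr '' S.sat ↔ p ∈ S.sat := by
  constructor
  · rintro ⟨q, hq, hqp⟩
    exact S.mem_sat_of_orbitRel h hq ((hpr.eq_iff q p (S.ne_zero_of_mem_sat h hq) hp).1 hqp)
  · exact mem_image_of_mem pr

theorem rep_mem_sat (h : IsPoleFlow φ) (hpr : IsOrbitMap φ pr) (S : Slice φ G) {q : Q}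
    (hq : q ∈ pr '' S.sat) : hpr.rep q ∈ S.sat := by
  rw [← S.mem_sat_iff_apply_mem h hpr (hpr.rep_ne_zero q), hpr.apply_rep]
  exact hq

theorem retr_rep (h : IsPoleFlow φ) (hpr : IsOrbitMap φ pr) (S : Slice φ G) {p : E × E}
    (hp : p ∈ S.sat) : S.retr (hpr.rep (pr p)) = S.retr p := by
  refine (S.retr_eq_of_orbitRel h hp ?_).symm
  rw [← hpr.eq_iff _ _ (S.ne_zero_of_mem_sat h hp) (hpr.rep_ne_zero _), hpr.apply_rep]

theorem apply_param_retr (h : IsPoleFlow φ) (hpr : IsOrbitMap φ pr) (S : Slice φ G) {p : E × E}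
    (hp : p ∈ S.sat) : pr (S.param (S.retr p)) = pr p :=
  (hpr.eq_iff _ _ (S.param_ne_zero _ (S.retr_mem p hp)) (S.ne_zero_of_mem_sat h hp)).2
    (S.orbitRel_retr p hp)

/-- The chart of the orbit space given by a slice. -/
def chart (h : IsPoleFlow φ) (hpr : IsOrbitMap φ pr) (S : Slice φ G) : OpenPartialHomeomorph Q G where
  toFun q := S.retr (hpr.rep q)
  invFun s := pr (S.param s)
  source := pr '' S.sat
  target := S.dom
  map_source' q hq := S.retr_mem _ (S.rep_mem_sat h hpr hq)
  map_target' s hs := mem_image_of_mem pr (S.param_mem_sat h hs)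
  left_inv' q hq := by
    rw [S.apply_param_retr h hpr (S.rep_mem_sat h hpr hq), hpr.apply_rep]
  right_inv' s hs := by
    rw [S.retr_rep h hpr (S.param_mem_sat h hs), S.retr_param h hs]
  open_source := hpr.isOpen_image h S.isOpen_sat fun _ ↦ S.ne_zero_of_mem_sat h
  open_target := S.isOpen_dom
  continuousOn_toFun := by
    rw [continuousOn_open_iff (hpr.isOpen_image h S.isOpen_sat fun _ ↦ S.ne_zero_of_mem_sat h)]
    intro O hO
    have : pr '' S.sat ∩ (fun q ↦ S.retr (hpr.rep q)) ⁻¹' O = pr '' (S.sat ∩ S.retr ⁻¹' O) := by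
      ext q
      constructor
      · rintro ⟨⟨p, hp, rfl⟩, hq⟩
        refine ⟨p, ⟨hp, ?_⟩, rfl⟩
        rwa [mem_preimage, S.retr_rep h hpr hp] at hq
      · rintro ⟨p, ⟨hp, hpO⟩, rfl⟩
        refine ⟨⟨p, hp, rfl⟩, ?_⟩
        rwa [mem_preimage, S.retr_rep h hpr hp]
    rw [this]
    exact hpr.isOpen_image h (S.contDiffOn_retr.continuousOn.isOpen_inter_preimage S.isOpen_sat hO)
      fun p hp ↦ S.ne_zero_of_mem_sat h hp.1
  continuousOn_invFun := hpr.continuousOn.comp S.contDiff_param.continuous.continuousOn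
    fun s hs ↦ S.param_ne_zero s hs

theorem chart_apply (h : IsPoleFlow φ) (hpr : IsOrbitMap φ pr) (S : Slice φ G) {p : E × E}
    (hp : p ∈ S.sat) : S.chart h hpr (pr p) = S.retr p := S.retr_rep h hpr hp

end Slice

end SliceLemmas

namespace IsOrbitMap

variable {E Q : Type*} [NormedAddCommGroup E] [InnerProductSpace ℝ E] [FiniteDimensional ℝ E]
  [TopologicalSpace Q] {φ : ℝ → E × E → E × E} {pr : E × E → Q}

/-- An open projection with closed equivalence relation has Hausdorff quotient. -/
theorem t2Space (h : IsPoleFlow φ) (hpr : IsOrbitMap φ pr) : T2Space Q := by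
  refine ⟨fun q q' hqq' ↦ ?_⟩
  obtain ⟨p, hp, rfl⟩ := hpr.surj q
  obtain ⟨p', hp', rfl⟩ := hpr.surj q'
  have hrel : ¬ OrbitRel φ p p' := fun hr ↦ hqq' ((hpr.eq_iff p p' hp hp').2 hr)
  have hev := h.eventually_not_orbitRel hp hp' hrel
  rw [nhds_prod_eq, eventually_prod_iff] at hev
  obtain ⟨P, hP, R, hR, hPR⟩ := hev
  obtain ⟨O, hOP, hO, hpO⟩ := eventually_nhds_iff.1 (hP.and (isOpen_ne.eventually_mem hp))
  obtain ⟨O', hOR, hO', hpO'⟩ := eventually_nhds_iff.1 (hR.and (isOpen_ne.eventually_mem hp'))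
  refine ⟨pr '' O, pr '' O', hpr.isOpen_image h hO fun z hz ↦ (hOP z hz).2,
    hpr.isOpen_image h hO' fun z hz ↦ (hOR z hz).2, ⟨p, hpO, rfl⟩, ⟨p', hpO', rfl⟩, ?_⟩
  rw [Set.disjoint_left]
  rintro _ ⟨z, hz, rfl⟩ ⟨z', hz', hzz'⟩
  exact hPR (hOP z hz).1 (hOR z' hz').1
    ((hpr.eq_iff z z' (hOP z hz).2 (hOR z' hz').2).1 hzz'.symm)

/-- Let A x be the set of geodesics through x. It is connected: in dimension one it is a single
point, although the nonzero vectors are disconnected, and otherwise the nonzero vectors are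
connected. Any A x and A y meet, in the geodesic joining x to y, or trivially when x = y. -/
theorem connectedSpace (h : IsPoleFlow φ) (hpr : IsOrbitMap φ pr)
    (hE : 0 < Module.finrank ℝ E) : ConnectedSpace Q := by
  have hne : ∃ v : E, v ≠ 0 := Module.finrank_pos_iff_exists_ne_zero.1 hE
  let A : E → Set Q := fun x ↦ (fun v ↦ pr (x, v)) '' {v | v ≠ 0}
  have hA : ∀ x, IsPreconnected (A x) := by
    intro x
    rcases (Nat.succ_le_of_lt hE).eq_or_lt with h1 | h1
    · refine Set.Subsingleton.isPreconnected ?_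
      rintro _ ⟨v, hv, rfl⟩ _ ⟨w, hw, rfl⟩
      obtain ⟨c, rfl⟩ := exists_smul_eq_of_finrank_eq_one h1.symm hv w
      exact (hpr.eq_iff (x, v) (x, _) hv hw).2 ⟨0, c, (smul_ne_zero_iff.1 hw).1, by simp [flowScale, h.zero]⟩
    · have h2 : IsPreconnected ({0}ᶜ : Set E) :=
        (isConnected_compl_singleton_of_one_lt_rank
          (by rw [← Module.finrank_eq_rank]; exact_mod_cast h1) 0).isPreconnected
      exact h2.image _ (hpr.continuousOn.comp (by fun_prop) fun v hv ↦ hv)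
  have hmeet : ∀ x y, (A x ∩ A y).Nonempty := by
    intro x y
    rcases eq_or_ne x y with rfl | hxy
    · obtain ⟨v, hv⟩ := hne
      exact ⟨_, ⟨v, hv, rfl⟩, ⟨v, hv, rfl⟩⟩
    · have hl : h.log x y ≠ 0 := by
        intro h0
        have := h.exp_log x y
        rw [h0, h.flow_zero_right] at this
        exact hxy this
      have hl2 := h.flow_snd_ne_zero 1 (p := (x, h.log x y)) hl
      refine ⟨_, ⟨_, hl, rfl⟩, ⟨(φ 1 (x, h.log x y)).2, hl2, ?_⟩⟩
      refine (hpr.eq_iff (y, _) (x, h.log x y) hl2 hl).2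
        (h.orbitRel_symm ⟨1, 1, one_ne_zero, ?_⟩)
      rw [flowScale, h.exp_log, one_smul]
  have huniv : (⋃ x, A 0 ∪ A x) = univ := by
    refine eq_univ_of_forall fun q ↦ ?_
    obtain ⟨p, hp, rfl⟩ := hpr.surj q
    exact mem_iUnion.2 ⟨p.1, Or.inr ⟨p.2, hp, rfl⟩⟩
  obtain ⟨v, hv⟩ := hne
  have hpre : IsPreconnected (⋃ x, A 0 ∪ A x) :=
    isPreconnected_iUnion ⟨pr (0, v), mem_iInter.2 fun x ↦ Or.inl ⟨v, hv, rfl⟩⟩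
      fun x ↦ (hA 0).union' (hmeet 0 x) (hA x)
  rw [huniv] at hpre
  exact { isPreconnected_univ := hpre, toNonempty := ⟨pr (0, v)⟩ }

theorem exists_slice_apply (h : IsPoleFlow φ) (hpr : IsOrbitMap φ pr) {k : ℕ}
    (hk : k = 2 * Module.finrank ℝ E - 2) (q : Q) : ∃ S : Slice φ (Model k), q ∈ pr '' S.sat := by
  obtain ⟨S, s, hs, hsp⟩ := h.exists_slice (hpr.rep_ne_zero q) hk
  exact ⟨S, S.param s, S.param_mem_sat h hs, by rw [hsp, hpr.apply_rep]⟩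

/-- The manifold structure of the orbit space. -/
abbrev chartedSpace (h : IsPoleFlow φ) (hpr : IsOrbitMap φ pr) {k : ℕ}
    (hk : k = 2 * Module.finrank ℝ E - 2) : ChartedSpace (Model k) Q where
  atlas := range fun S : Slice φ (Model k) ↦ S.chart h hpr
  chartAt q := (hpr.exists_slice_apply h hk q).choose.chart h hpr
  mem_chart_source q := (hpr.exists_slice_apply h hk q).choose_spec
  chart_mem_atlas _ := mem_range_self _

/-- A transition map is the parametrization of one slice followed by the retraction onto another. -/
theorem isManifold (h : IsPoleFlow φ) (hpr : IsOrbitMap φ pr) {k : ℕ}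
    (hk : k = 2 * Module.finrank ℝ E - 2) :
    letI := hpr.chartedSpace h hk
    IsManifold (𝓡 k) ∞ Q := by
  let := hpr.chartedSpace h hk
  refine isManifold_of_contDiffOn (𝓡 k) ∞ Q ?_
  rintro _ _ ⟨S, rfl⟩ ⟨S', rfl⟩
  simp only [modelWithCornersSelf_coe, modelWithCornersSelf_coe_symm, Function.comp_id,
    Function.id_comp, preimage_id, range_id, inter_univ]
  have hmaps : ∀ s ∈ ((S.chart h hpr).symm ≫ₕ S'.chart h hpr).source, S.param s ∈ S'.sat := by
    intro s hs
    rw [OpenPartialHomeomorph.trans_source] at hs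
    exact (S'.mem_sat_iff_apply_mem h hpr (S.param_ne_zero s hs.1)).1 hs.2
  refine (S'.contDiffOn_retr.comp S.contDiff_param.contDiffOn hmaps).congr fun s hs ↦ ?_
  exact S'.chart_apply h hpr (hmaps s hs)

theorem contMDiffAt (h : IsPoleFlow φ) (hpr : IsOrbitMap φ pr) {k : ℕ}
    (hk : k = 2 * Module.finrank ℝ E - 2) {p : E × E} (hp : p.2 ≠ 0) :
    letI := hpr.chartedSpace h hk
    ContMDiffAt 𝓘(ℝ, E × E) (𝓡 k) ∞ pr p := by
  let := hpr.chartedSpace h hk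
  rw [contMDiffAt_iff_target]
  refine ⟨hpr.continuousOn.continuousAt (isOpen_ne.mem_nhds hp), ?_⟩
  set S := (hpr.exists_slice_apply h hk (pr p)).choose with hS
  have hpS : p ∈ S.sat := (S.mem_sat_iff_apply_mem h hpr hp).1
    (hpr.exists_slice_apply h hk (pr p)).choose_spec
  have h1 : ContDiffAt ℝ ∞ S.retr p := S.contDiffOn_retr.contDiffAt (S.isOpen_sat.mem_nhds hpS)
  refine (contMDiffAt_iff_contDiffAt.2 h1).congr_of_eventuallyEq ?_
  filter_upwards [S.isOpen_sat.mem_nhds hpS] with z hz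
  exact S.chart_apply h hpr hz

/-- Choose a slice through p itself. Its inverse chart is `pr` ∘ `param`, whose derivative is
surjective and factors through that of `pr`. -/
theorem mfderiv_surjective (h : IsPoleFlow φ) (hpr : IsOrbitMap φ pr) {k : ℕ}
    (hk : k = 2 * Module.finrank ℝ E - 2) {p : E × E} (hp : p.2 ≠ 0) :
    letI := hpr.chartedSpace h hk
    Function.Surjective (mfderiv 𝓘(ℝ, E × E) (𝓡 k) pr p) := by
  let := hpr.chartedSpace h hk
  have := hpr.isManifold h hk
  have : IsManifold (𝓡 k) 1 Q := IsManifold.of_le (n := ∞) (by simp)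
  obtain ⟨S, s, hs, rfl⟩ := h.exists_slice hp hk
  have h1 : (S.chart h hpr).MDifferentiable (𝓡 k) (𝓡 k) :=
    mdifferentiable_of_mem_atlas (mem_range_self S)
  have h2 := h1.symm.mfderiv_surjective (x := s) hs
  have h3 : mfderiv (𝓡 k) (𝓡 k) (S.chart h hpr).symm s =
      (mfderiv 𝓘(ℝ, E × E) (𝓡 k) pr (S.param s)).comp
        (mfderiv (𝓡 k) 𝓘(ℝ, E × E) S.param s) :=
    mfderiv_comp s ((hpr.contMDiffAt h hk hp).mdifferentiableAt (by simp))
      (S.contDiff_param.contMDiff.mdifferentiableAt (by simp))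
  intro w
  obtain ⟨u, hu⟩ := h2 w
  rw [h3] at hu
  exact ⟨_, hu⟩

/-- Second countability descends along the open quotient map, and the charts give local compactness.
-/
theorem paracompactSpace (h : IsPoleFlow φ) (hpr : IsOrbitMap φ pr) : ParacompactSpace Q := by
  let := hpr.chartedSpace h rfl
  have := hpr.t2Space h
  have hq := hpr.isOpenQuotientMap h
  have : SecondCountableTopology Q :=
    hq.isQuotientMap.secondCountableTopology hq.isOpenMap
  have : LocallyCompactSpace Q := Manifold.locallyCompact_of_finiteDimensional
    (𝓡 (2 * Module.finrank ℝ E - 2))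
  infer_instance

end IsOrbitMap

/-! ### Bilinearity and smoothness of Christoffel symbols -/

section Christoffel

variable {n : ℕ} {M : Type*} [TopologicalSpace M] [ChartedSpace (Model n) M]
  [IsManifold (𝓡 n) ∞ M]

theorem contMDiffOn_symmL (x₀ : M) (w : Model n) :
    ContMDiffOn (𝓡 n) (𝓡 n).tangent ∞ (fun z ↦ (⟨z,
      (trivializationAt (Model n) (TangentSpace (𝓡 n) : M → Type _) x₀).symmL ℝ z w⟩ :
        TangentBundle (𝓡 n) M)) (chartAt (Model n) x₀).source := by
  set e := trivializationAt (Model n) (TangentSpace (𝓡 n) : M → Type _) x₀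
  have : IsManifold (𝓡 n) (∞ + 1) M := ‹IsManifold (𝓡 n) ∞ M›
  change ContMDiffOn (𝓡 n) ((𝓡 n).prod 𝓘(ℝ, Model n)) ∞
    (fun z ↦ TotalSpace.mk' (Model n) z (e.symmL ℝ z w)) e.baseSet
  rw [e.contMDiffOn_section_baseSet_iff]
  refine (contMDiffOn_const (c := w)).congr fun z hz ↦ ?_
  have := e.continuousLinearMapAt_symmL (R := ℝ) hz w
  rwa [e.continuousLinearMapAt_apply_of_mem ℝ hz] at this

theorem mdifferentiableAt_symmL {x₀ y : M} (hy : y ∈ (chartAt (Model n) x₀).source) (w : Model n) :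
    MDifferentiableAt (𝓡 n) (𝓡 n).tangent (fun z ↦ (⟨z,
      (trivializationAt (Model n) (TangentSpace (𝓡 n) : M → Type _) x₀).symmL ℝ z w⟩ :
        TangentBundle (𝓡 n) M)) y :=
  ((contMDiffOn_symmL x₀ w).contMDiffAt ((chartAt (Model n) x₀).open_source.mem_nhds hy)
    ).mdifferentiableAt (by simp)

/-- The Christoffel symbol at a point of the chart domain, as a bilinear map. -/
def christoffelBilin (cov : LinearConnection n M) {x₀ y : M}
    (hy : y ∈ (chartAt (Model n) x₀).source) : Model n →ₗ[ℝ] Model n →ₗ[ℝ] Model n :=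
  LinearMap.mk₂ ℝ (christoffel cov x₀ y)
    (fun v v' w ↦ by simp [christoffel])
    (fun c v w ↦ by simp [christoffel])
    (fun v w w' ↦ by
      have h := cov.isCovariantDerivativeOnUniv.add (mdifferentiableAt_symmL hy w)
        (mdifferentiableAt_symmL hy w')
      simp only [christoffel, map_add]
      erw [h]
      simp)
    (fun c v w ↦ by
      have h := cov.isCovariantDerivativeOnUniv.smul_const c (mdifferentiableAt_symmL hy w)
      simp only [christoffel, map_smul]
      erw [h]
      simp)

theorem christoffel_smul (cov : LinearConnection n M) {x₀ y : M}
    (hy : y ∈ (chartAt (Model n) x₀).source) (c : ℝ) (w : Model n) :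
    christoffel cov x₀ y (c • w) (c • w) = (c * c) • christoffel cov x₀ y w w := by
  change christoffelBilin cov hy (c • w) (c • w) = (c * c) • christoffelBilin cov hy w w
  simp [smul_smul]

/-- Reduces joint smoothness in the point and the vectors to that of finitely many functions of the
point. -/
theorem christoffel_eq_sum (cov : LinearConnection n M) {x₀ y : M}
    (hy : y ∈ (chartAt (Model n) x₀).source) (v w : Model n) :
    christoffel cov x₀ y v w = ∑ i, ∑ j, (v i * w j) •
      christoffel cov x₀ y (EuclideanSpace.single i 1) (EuclideanSpace.single j 1) := by
  have hb : ∀ u : Model n, u = ∑ i, u i • EuclideanSpace.single i (1 : ℝ) := fun u ↦ by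
    have := (EuclideanSpace.basisFun (Fin n) ℝ).sum_repr u
    simpa using this.symm
  change christoffelBilin cov hy v w = ∑ i, ∑ j, (v i * w j) • christoffelBilin cov hy _ _
  conv_lhs => rw [hb v, hb w]
  simp only [map_sum, map_smul, LinearMap.sum_apply, LinearMap.smul_apply, Finset.smul_sum, smul_smul]
  rw [Finset.sum_comm]
  exact Finset.sum_congr rfl fun i _ ↦ Finset.sum_congr rfl fun j _ ↦ by rw [mul_comm]

variable [T2Space M]

/-- Smoothness of the connection is applied to a global field, whereas coordinate fields are known
to be smooth only on the chart domain. A bump function globalizes the field, and locality of the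
covariant derivative shows that nothing changes near y₀. -/
theorem contMDiffOn_christoffel {cov : LinearConnection n M}
    (hcov : CovariantDerivative.ContMDiffCovariantDerivative cov ∞) (x₀ : M) (v w : Model n) :
    ContMDiffOn (𝓡 n) 𝓘(ℝ, Model n) ∞ (fun y ↦ christoffel cov x₀ y v w)
      (chartAt (Model n) x₀).source := by
  have : IsManifold (𝓡 n) (∞ + 1) M := ‹IsManifold (𝓡 n) ∞ M›
  intro y₀ hy₀
  refine ContMDiffAt.contMDiffWithinAt ?_
  set e := trivializationAt (Model n) (TangentSpace (𝓡 n) : M → Type _) x₀ with he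
  have hsource : (chartAt (Model n) x₀).source ∈ 𝓝 y₀ :=
    (chartAt (Model n) x₀).open_source.mem_nhds hy₀
  obtain ⟨f, -, hf⟩ := (SmoothBumpFunction.nhds_basis_tsupport (I := 𝓡 n) y₀).mem_iff.1 hsource
  let σ : (z : M) → TangentSpace (𝓡 n) z := fun z ↦ e.symmL ℝ z w
  have hσ : ContMDiff (𝓡 n) (𝓡 n).tangent ∞ (fun z ↦ (⟨z, ((f : M → ℝ) • σ) z⟩ :
      TangentBundle (𝓡 n) M)) :=
    ContMDiffOn.smul_section_of_tsupport f.contMDiff.contMDiffOn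
      (chartAt (Model n) x₀).open_source hf (contMDiffOn_symmL x₀ w)
  have hc := (hcov.contMDiff.contMDiff (σ := (f : M → ℝ) • σ)
    (hσ.contMDiffOn (s := univ))).contMDiffAt (univ_mem (f := 𝓝 y₀))
  have hv : ContMDiffAt (𝓡 n) ((𝓡 n).prod 𝓘(ℝ, Model n)) ∞
      (fun z ↦ TotalSpace.mk' (Model n) z (e.symmL ℝ z v)) y₀ :=
    (contMDiffOn_symmL x₀ v).contMDiffAt hsource
  have happ := ContMDiffAt.clm_bundle_apply hc hv
  rw [e.contMDiffAt_section_iff hy₀] at happ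
  refine happ.congr_of_eventuallyEq ?_
  filter_upwards [hsource, f.eventuallyEq_one.eventually_nhds] with y hy hfy
  have hcongr : cov ((f : M → ℝ) • σ) y = cov σ y := by
    refine cov.isCovariantDerivativeOnUniv.congr_of_eventuallyEq
      (hσ.contMDiffAt.mdifferentiableAt (by simp)) (mdifferentiableAt_symmL hy w) univ_mem ?_
    filter_upwards [hfy] with z hz
    simp [hz]
  rw [christoffel, ← hcongr, e.continuousLinearMapAt_apply_of_mem ℝ hy]

end Christoffel

theorem deriv_deriv_comp {E F : Type*} [NormedAddCommGroup E] [NormedSpace ℝ E]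
    [NormedAddCommGroup F] [NormedSpace ℝ F] {c : E → F} {u : ℝ → E} {t : ℝ}
    (hc : ContDiffAt ℝ ∞ c (u t)) (hu : ContDiffAt ℝ ∞ u t) :
    deriv (deriv fun s ↦ c (u s)) t =
      fderiv ℝ (fderiv ℝ c) (u t) (deriv u t) (deriv u t) + fderiv ℝ c (u t) (deriv (deriv u) t) := by
  have hc2 : ContDiffAt ℝ 2 c (u t) := hc.of_le (WithTop.coe_le_coe.2 (le_top : (2 : ℕ∞) ≤ ⊤))
  have hu2 : ContDiffAt ℝ 2 u t := hu.of_le (WithTop.coe_le_coe.2 (le_top : (2 : ℕ∞) ≤ ⊤))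
  have hcd : ∀ᶠ x in 𝓝 (u t), DifferentiableAt ℝ c x :=
    (hc2.eventually (by simp)).mono fun x hx ↦ hx.differentiableAt (by simp)
  have hud : ∀ᶠ s in 𝓝 t, DifferentiableAt ℝ u s :=
    (hu2.eventually (by simp)).mono fun x hx ↦ hx.differentiableAt (by simp)
  have h1 : deriv (fun s ↦ c (u s)) =ᶠ[𝓝 t] fun s ↦ fderiv ℝ c (u s) (deriv u s) := by
    filter_upwards [hu.continuousAt.eventually hcd, hud] with s hs1 hs2
    exact (hs1.hasFDerivAt.comp_hasDerivAt s hs2.hasDerivAt).deriv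
  have h2 : HasFDerivAt (fderiv ℝ c) (fderiv ℝ (fderiv ℝ c) (u t)) (u t) :=
    ((hc2.fderiv_right (m := 1) (by norm_num)).differentiableAt (by simp)).hasFDerivAt
  have h3 : HasDerivAt (deriv u) (deriv (deriv u) t) t := by
    refine DifferentiableAt.hasDerivAt ?_
    have : ContDiffAt ℝ 1 (fderiv ℝ u) t := hu2.fderiv_right (by norm_num)
    exact (this.differentiableAt (by simp)).clm_apply (differentiableAt_const (1 : ℝ))
  have h4 := h2.comp_hasDerivAt t (hu.differentiableAt (by simp)).hasDerivAt
  rw [h1.deriv_eq]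
  exact (h4.clm_apply h3).deriv

/-! ### The geodesic equation in global coordinates -/

section Coordinates

variable {n : ℕ} {M : Type*} [TopologicalSpace M] [ChartedSpace (Model n) M]

/-- Global coordinates on `M`. -/
abbrev GlobalChart (n : ℕ) (M : Type*) [TopologicalSpace M] [ChartedSpace (Model n) M] : Type _ :=
  Diffeomorph 𝓘(ℝ, Model n) (𝓡 n) (Model n) M ∞

namespace GlobalChart

variable (Φ : GlobalChart n M) (x₀ : M)

/-- The change from global coordinates to the chart around `x₀`. -/
def toChart (y : Model n) : Model n := extChartAt (𝓡 n) x₀ (Φ y)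

/-- The change from the chart around `x₀` to global coordinates. -/
def ofChart (u : Model n) : Model n := Φ.symm ((extChartAt (𝓡 n) x₀).symm u)

/-- The domain of the chart around `x₀`, in global coordinates. -/
def chartDomain : Set (Model n) := Φ ⁻¹' (chartAt (Model n) x₀).source

theorem isOpen_chartDomain : IsOpen (Φ.chartDomain x₀) :=
  (chartAt (Model n) x₀).open_source.preimage Φ.continuous

theorem mem_extChartAt_source {y : Model n} (hy : y ∈ Φ.chartDomain x₀) :
    Φ y ∈ (extChartAt (𝓡 n) x₀).source := by rwa [extChartAt_source]

theorem ofChart_toChart {y : Model n} (hy : y ∈ Φ.chartDomain x₀) :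
    Φ.ofChart x₀ (Φ.toChart x₀ y) = y := by
  rw [ofChart, toChart, (extChartAt (𝓡 n) x₀).left_inv (Φ.mem_extChartAt_source x₀ hy)]
  exact Φ.symm_apply_apply y

theorem toChart_ofChart {u : Model n} (hu : u ∈ (extChartAt (𝓡 n) x₀).target) :
    Φ.toChart x₀ (Φ.ofChart x₀ u) = u := by
  rw [ofChart, toChart, Φ.apply_symm_apply, (extChartAt (𝓡 n) x₀).right_inv hu]

theorem toChart_mem_target {y : Model n} (hy : y ∈ Φ.chartDomain x₀) :
    Φ.toChart x₀ y ∈ (extChartAt (𝓡 n) x₀).target :=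
  (extChartAt (𝓡 n) x₀).map_source (Φ.mem_extChartAt_source x₀ hy)

variable [IsManifold (𝓡 n) ∞ M]

theorem contDiffAt_toChart {y : Model n} (hy : y ∈ Φ.chartDomain x₀) :
    ContDiffAt ℝ ∞ (Φ.toChart x₀) y := by
  rw [← contMDiffAt_iff_contDiffAt]
  exact (contMDiffAt_extChartAt' hy).comp y Φ.contMDiff.contMDiffAt

theorem contDiffAt_ofChart {u : Model n} (hu : u ∈ (extChartAt (𝓡 n) x₀).target) :
    ContDiffAt ℝ ∞ (Φ.ofChart x₀) u := by
  rw [← contMDiffAt_iff_contDiffAt]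
  refine Φ.symm.contMDiff.contMDiffAt.comp u ?_
  exact (contMDiffOn_extChartAt_symm x₀).contMDiffAt
    ((isOpen_extChartAt_target x₀).mem_nhds hu)

theorem fderiv_toChart_fderiv_ofChart {u : Model n} (hu : u ∈ (extChartAt (𝓡 n) x₀).target)
    (hy : Φ.ofChart x₀ u ∈ Φ.chartDomain x₀) (w : Model n) :
    fderiv ℝ (Φ.toChart x₀) (Φ.ofChart x₀ u) (fderiv ℝ (Φ.ofChart x₀) u w) = w := by
  have h1 := ((Φ.contDiffAt_toChart x₀ hy).differentiableAt (by simp)).hasFDerivAt.comp u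
    ((Φ.contDiffAt_ofChart x₀ hu).differentiableAt (by simp)).hasFDerivAt
  have h2 : HasFDerivAt (Φ.toChart x₀ ∘ Φ.ofChart x₀) (ContinuousLinearMap.id ℝ _) u := by
    refine (hasFDerivAt_id u).congr_of_eventuallyEq ?_
    filter_upwards [(isOpen_extChartAt_target x₀).mem_nhds hu] with v hv
    exact Φ.toChart_ofChart x₀ hv
  exact DFunLike.congr_fun (h1.unique h2) w

/-- The acceleration, in global coordinates, of the geodesic with the given position and velocity,
computed by means of the chart around `x₀`. -/
def chartAccel (cov : LinearConnection n M) (p : Model n × Model n) : Model n :=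
  let w := fderiv ℝ (Φ.toChart x₀) p.1 p.2
  fderiv ℝ (fderiv ℝ (Φ.ofChart x₀)) (Φ.toChart x₀ p.1) w w -
    fderiv ℝ (Φ.ofChart x₀) (Φ.toChart x₀ p.1) (christoffel cov x₀ (Φ p.1) w w)

theorem chartAccel_smul (cov : LinearConnection n M) {y : Model n} (hy : y ∈ Φ.chartDomain x₀)
    (c : ℝ) (z : Model n) :
    Φ.chartAccel x₀ cov (y, c • z) = (c * c) • Φ.chartAccel x₀ cov (y, z) := by
  simp only [chartAccel, map_smul, christoffel_smul cov hy, smul_apply,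
    smul_sub, smul_smul]

/-- Write y as `ofChart` of its chart expression and differentiate twice. The derivative of
`ofChart` is injective, so it can be cancelled to return to the chart equation. -/
theorem geodesic_equation_iff (cov : LinearConnection n M) {y : ℝ → Model n} {t : ℝ}
    (hy : ContDiffAt ℝ ∞ y t) (ht : y t ∈ Φ.chartDomain x₀) :
    deriv (deriv fun s ↦ Φ.toChart x₀ (y s)) t + christoffel cov x₀ (Φ (y t))
      (deriv (fun s ↦ Φ.toChart x₀ (y s)) t) (deriv (fun s ↦ Φ.toChart x₀ (y s)) t) = 0 ↔
    deriv (deriv y) t = Φ.chartAccel x₀ cov (y t, deriv y t) := by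
  have hu : ContDiffAt ℝ ∞ (fun s ↦ Φ.toChart x₀ (y s)) t :=
    ContDiffAt.comp (g := Φ.toChart x₀) t (Φ.contDiffAt_toChart x₀ ht) hy
  have hu' : deriv (fun s ↦ Φ.toChart x₀ (y s)) t =
      fderiv ℝ (Φ.toChart x₀) (y t) (deriv y t) :=
    (((Φ.contDiffAt_toChart x₀ ht).differentiableAt (by simp)).hasFDerivAt.comp_hasDerivAt t
      (hy.differentiableAt (by simp)).hasDerivAt).deriv
  have hyu : y =ᶠ[𝓝 t] fun s ↦ Φ.ofChart x₀ (Φ.toChart x₀ (y s)) := by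
    filter_upwards [hy.continuousAt.eventually_mem ((Φ.isOpen_chartDomain x₀).mem_nhds ht)]
      with s hs
    exact (Φ.ofChart_toChart x₀ hs).symm
  have hmem := Φ.toChart_mem_target x₀ ht
  have hback := Φ.ofChart_toChart x₀ ht
  have hc := Φ.contDiffAt_ofChart x₀ hmem
  have hdd := deriv_deriv_comp (u := fun s ↦ Φ.toChart x₀ (y s)) hc hu
  rw [(hyu.deriv).deriv_eq, hdd, chartAccel]
  simp only
  rw [hu', sub_eq_add_neg, add_right_inj, ← map_neg]
  constructor
  · intro h0
    rw [eq_neg_of_add_eq_zero_left h0]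
  · intro h0
    have hinj : Function.Injective (fderiv ℝ (Φ.ofChart x₀) (Φ.toChart x₀ (y t))) :=
      Function.LeftInverse.injective
        (Φ.fderiv_toChart_fderiv_ofChart x₀ hmem (by rwa [hback]))
    rw [hinj h0, neg_add_cancel]

variable [T2Space M]

theorem contDiffAt_chartAccel {cov : LinearConnection n M}
    (hcov : CovariantDerivative.ContMDiffCovariantDerivative cov ∞) {p : Model n × Model n}
    (hp : p.1 ∈ Φ.chartDomain x₀) : ContDiffAt ℝ ∞ (Φ.chartAccel x₀ cov) p := by
  have hb : ContDiffAt ℝ ∞ (Φ.toChart x₀) p.1 := Φ.contDiffAt_toChart x₀ hp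
  have hmem := Φ.toChart_mem_target x₀ hp
  have hc : ContDiffAt ℝ ∞ (Φ.ofChart x₀) (Φ.toChart x₀ p.1) := Φ.contDiffAt_ofChart x₀ hmem
  have hdc : ContDiffAt ℝ ∞ (fderiv ℝ (Φ.ofChart x₀)) (Φ.toChart x₀ p.1) :=
    hc.fderiv_right (by simp)
  have hddc : ContDiffAt ℝ ∞ (fderiv ℝ (fderiv ℝ (Φ.ofChart x₀))) (Φ.toChart x₀ p.1) :=
    hdc.fderiv_right (by simp)
  have hb1 : ContDiffAt ℝ ∞ (fun q : Model n × Model n ↦ Φ.toChart x₀ q.1) p :=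
    ContDiffAt.comp (g := Φ.toChart x₀) p hb contDiffAt_fst
  have hw : ContDiffAt ℝ ∞ (fun q : Model n × Model n ↦ fderiv ℝ (Φ.toChart x₀) q.1 q.2) p :=
    (ContDiffAt.comp (g := fderiv ℝ (Φ.toChart x₀)) p
      (hb.fderiv_right (by simp)) contDiffAt_fst).clm_apply contDiffAt_snd
  have hchr : ∀ v w, ContDiffAt ℝ ∞ (fun y ↦ christoffel cov x₀ (Φ y) v w) p.1 := by
    intro v w
    rw [← contMDiffAt_iff_contDiffAt]
    exact ((contMDiffOn_christoffel hcov x₀ v w).contMDiffAt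
      ((chartAt (Model n) x₀).open_source.mem_nhds hp)).comp p.1 Φ.contMDiff.contMDiffAt
  have hcoord : ∀ i, ContDiffAt ℝ ∞
      (fun q : Model n × Model n ↦ (fderiv ℝ (Φ.toChart x₀) q.1 q.2) i) p := fun i ↦
    ContDiffAt.comp p (g := (EuclideanSpace.proj i : Model n →L[ℝ] ℝ))
      (EuclideanSpace.proj i : Model n →L[ℝ] ℝ).contDiff.contDiffAt hw
  have hG : ContDiffAt ℝ ∞ (fun q : Model n × Model n ↦ christoffel cov x₀ (Φ q.1)
      (fderiv ℝ (Φ.toChart x₀) q.1 q.2) (fderiv ℝ (Φ.toChart x₀) q.1 q.2)) p := by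
    have hsum : ContDiffAt ℝ ∞ (fun q : Model n × Model n ↦ ∑ i, ∑ j,
        ((fderiv ℝ (Φ.toChart x₀) q.1 q.2) i * (fderiv ℝ (Φ.toChart x₀) q.1 q.2) j) •
          christoffel cov x₀ (Φ q.1) (EuclideanSpace.single i 1) (EuclideanSpace.single j 1)) p :=
      ContDiffAt.sum fun i _ ↦ ContDiffAt.sum fun j _ ↦
        ((hcoord i).mul (hcoord j)).smul (ContDiffAt.comp p (hchr _ _) contDiffAt_fst)
    refine hsum.congr_of_eventuallyEq ?_
    filter_upwards [continuousAt_fst.eventually_mem ((Φ.isOpen_chartDomain x₀).mem_nhds hp)]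
      with q hq
    exact christoffel_eq_sum cov hq _ _
  exact (((ContDiffAt.comp (g := fderiv ℝ (fderiv ℝ (Φ.ofChart x₀))) p hddc hb1).clm_apply
    hw).clm_apply hw).sub
      ((ContDiffAt.comp (g := fderiv ℝ (Φ.ofChart x₀)) p hdc hb1).clm_apply hG)

end GlobalChart

end Coordinates

/-! ### Completeness of homogeneous second order equations -/

section Spray

variable {E : Type*} [NormedAddCommGroup E] [NormedSpace ℝ E]

/-- The first order vector field of the second order equation `y'' = X (y, y')`. -/
def sprayField {E : Type*} (X : E × E → E) (p : E × E) : E × E := (p.2, X p)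

theorem hasDerivAt_rescale {X : E × E → E}
    (hhom : ∀ y z (c : ℝ), X (y, c • z) = (c * c) • X (y, z)) {α : ℝ → E × E} {c s : ℝ}
    (h : HasDerivAt α (sprayField X (α (c * s))) (c * s)) :
    HasDerivAt (fun s ↦ ((α (c * s)).1, c • (α (c * s)).2))
      (sprayField X ((α (c * s)).1, c • (α (c * s)).2)) s := by
  have h1 : HasDerivAt (fun s : ℝ ↦ c * s) c s := by
    simpa using (hasDerivAt_id s).const_mul c
  have h2 : HasDerivAt (fun s ↦ α (c * s)) (c • sprayField X (α (c * s))) s :=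
    HasDerivAt.scomp s h h1
  have h3 : HasDerivAt (fun s ↦ (α (c * s)).1) (c • (α (c * s)).2) s :=
    (ContinuousLinearMap.fst ℝ E E).hasFDerivAt.comp_hasDerivAt s h2
  have h4 : HasDerivAt (fun s ↦ (α (c * s)).2) (c • X (α (c * s))) s :=
    (ContinuousLinearMap.snd ℝ E E).hasFDerivAt.comp_hasDerivAt s h2
  have h5 := h3.prodMk (h4.const_smul c)
  rwa [smul_smul, ← hhom] at h5

variable [FiniteDimensional ℝ E]

/-- If `X` is homogeneous of degree two in the velocity and the solutions of `y'' = X (y, y')` all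
exist up to time `1`, then they exist for all times. -/
theorem exists_flow_of_homogeneous {X : E × E → E} (hX : ContDiff ℝ ∞ X)
    (hhom : ∀ y z (c : ℝ), X (y, c • z) = (c * c) • X (y, z))
    (hex : ∀ p : E × E, ∃ (α : ℝ → E × E) (J : Set ℝ), IsOpen J ∧ J.OrdConnected ∧
      Icc 0 1 ⊆ J ∧ α 0 = p ∧ ∀ t ∈ J, HasDerivAt α (sprayField X (α t)) t) :
    ∃ φ : ℝ → E × E → E × E, (∀ p, φ 0 p = p) ∧
      ∀ p t, HasDerivAt (fun s ↦ φ s p) (sprayField X (φ t p)) t := by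
  choose σ J hJo hJc hJ h0 hσ using hex
  have hF : ContDiff ℝ ∞ (sprayField X) := contDiff_snd.prodMk hX
  -- The solution with initial velocity T • p.2, valid up to time one, is slowed down by the factor
  -- T; it then starts at p and is valid up to time T.
  let τ : E × E → ℝ → ℝ → E × E := fun p T s ↦
    ((σ (p.1, T • p.2) (T⁻¹ * s)).1, T⁻¹ • (σ (p.1, T • p.2) (T⁻¹ * s)).2)
  let D : E × E → ℝ → Set ℝ := fun p T ↦ (fun s ↦ T⁻¹ * s) ⁻¹' J (p.1, T • p.2)
  have hDo : ∀ p T, IsOpen (D p T) := fun p T ↦ (hJo _).preimage (by fun_prop)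
  have hDc : ∀ p T, (D p T).OrdConnected := by
    intro p T
    rcases le_total 0 T⁻¹ with hT | hT
    · exact (hJc _).preimage_mono fun a b hab ↦ mul_le_mul_of_nonneg_left hab hT
    · exact (hJc _).preimage_anti fun a b hab ↦ mul_le_mul_of_nonpos_left hab hT
  have hD0 : ∀ p T, (0 : ℝ) ∈ D p T := fun p T ↦ hJ _ (by simp)
  have hDT : ∀ p T, T ≠ 0 → T ∈ D p T := fun p T hT ↦ hJ _ (by simp [hT])
  have hτ0 : ∀ p T, T ≠ 0 → τ p T 0 = p := by
    intro p T hT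
    simp [τ, h0, smul_smul, hT]
  have hτ : ∀ p T, T ≠ 0 → ∀ s ∈ D p T, HasDerivAt (τ p T) (sprayField X (τ p T s)) s :=
    fun p T _ s hs ↦ hasDerivAt_rescale hhom (hσ _ _ hs)
  -- The value at time s uses T = s, with s = 0 separate because T must be invertible. By uniqueness
  -- any other T whose domain contains s gives the same value, so φ is locally a single solution.
  let φ : ℝ → E × E → E × E := fun s p ↦ if s = 0 then p else τ p s s
  have hφ : ∀ p T, T ≠ 0 → ∀ s ∈ D p T, φ s p = τ p T s := by
    intro p T hT s hs
    by_cases hs0 : s = 0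
    · simp only [φ, hs0, if_true, hτ0 p T hT]
    · simp only [φ, hs0, if_false]
      exact eqOn_of_hasDerivAt hF ((hDc p s).inter (hDc p T)) (fun t ht ↦ hτ p s hs0 t ht.1)
        (fun t ht ↦ hτ p T hT t ht.2) ⟨hD0 p s, hD0 p T⟩ (by rw [hτ0 p s hs0, hτ0 p T hT])
        ⟨hDT p s hs0, hs⟩
  refine ⟨φ, fun p ↦ by simp [φ], fun p t ↦ ?_⟩
  obtain ⟨T, hT, ht⟩ : ∃ T, T ≠ 0 ∧ t ∈ D p T := by
    by_cases ht : t = 0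
    · exact ⟨1, one_ne_zero, ht ▸ hD0 p 1⟩
    · exact ⟨t, ht, hDT p t ht⟩
  rw [hφ p T hT t ht]
  refine (hτ p T hT t ht).congr_of_eventuallyEq ?_
  filter_upwards [(hDo p T).mem_nhds ht] with s hs
  exact hφ p T hT s hs

theorem flow_smul_of_homogeneous {X : E × E → E} (hX : ContDiff ℝ ∞ X)
    (hhom : ∀ y z (c : ℝ), X (y, c • z) = (c * c) • X (y, z)) {φ : ℝ → E × E → E × E}
    (h0 : ∀ p, φ 0 p = p) (hφ : ∀ p t, HasDerivAt (fun s ↦ φ s p) (sprayField X (φ t p)) t)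
    (t c : ℝ) (x v : E) :
    φ t (x, c • v) = ((φ (c * t) (x, v)).1, c • (φ (c * t) (x, v)).2) := by
  have hF : ContDiff ℝ ∞ (sprayField X) := contDiff_snd.prodMk hX
  exact eqOn_of_hasDerivAt hF ordConnected_univ (t₀ := 0)
    (β := fun t ↦ ((φ (c * t) (x, v)).1, c • (φ (c * t) (x, v)).2))
    (fun t _ ↦ hφ (x, c • v) t) (fun s _ ↦ hasDerivAt_rescale hhom (hφ (x, v) (c * s)))
    (mem_univ _) (by simp [h0]) (mem_univ t)

end Spray

/-! ### Tangent vectors in global coordinates -/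

section Coordinates

variable {n : ℕ} {M : Type*} [TopologicalSpace M] [ChartedSpace (Model n) M]

namespace GlobalChart

variable (Φ : GlobalChart n M)

theorem mfderiv_symm_mfderiv (y z : Model n) :
    mfderiv (𝓡 n) 𝓘(ℝ, Model n) Φ.symm (Φ y) (mfderiv 𝓘(ℝ, Model n) (𝓡 n) Φ y z) = z := by
  have h := mfderiv_comp y (Φ.symm.contMDiff.mdifferentiable (by simp) (Φ y))
    (Φ.contMDiff.mdifferentiable (by simp) y)
  have h2 : Φ.symm ∘ Φ = id := funext Φ.symm_apply_apply
  rw [h2, mfderiv_id] at h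
  exact (DFunLike.congr_fun h z).symm

theorem mfderiv_mfderiv_symm (x : M) (v : TangentSpace (𝓡 n) x) :
    (⟨Φ (Φ.symm x), mfderiv 𝓘(ℝ, Model n) (𝓡 n) Φ (Φ.symm x)
      (mfderiv (𝓡 n) 𝓘(ℝ, Model n) Φ.symm x v)⟩ : TangentBundle (𝓡 n) M) = ⟨x, v⟩ := by
  have h := mfderiv_comp x (Φ.contMDiff.mdifferentiable (by simp) (Φ.symm x))
    (Φ.symm.contMDiff.mdifferentiable (by simp) x)
  have h2 : Φ ∘ Φ.symm = id := funext Φ.apply_symm_apply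
  rw [h2, mfderiv_id] at h
  have h3 := DFunLike.congr_fun h v
  have h4 : Φ (Φ.symm x) = x := Φ.apply_symm_apply x
  exact TotalSpace.ext h4 (heq_of_eq h3.symm)

theorem mem_chartDomain_self (y : Model n) : y ∈ Φ.chartDomain (Φ y) :=
  mem_chart_source (Model n) (Φ y)

theorem contDiffAt_symm_comp {γ : ℝ → M} {t : ℝ} (hγ : ContMDiffAt 𝓘(ℝ, ℝ) (𝓡 n) ∞ γ t) :
    ContDiffAt ℝ ∞ (fun s ↦ Φ.symm (γ s)) t := by
  rw [← contMDiffAt_iff_contDiffAt]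
  exact Φ.symm.contMDiff.contMDiffAt.comp t hγ

/-- Position and velocity, in global coordinates, of a tangent vector. -/
def coord (v : TangentBundle (𝓡 n) M) : Model n × Model n :=
  (Φ.symm v.1, mfderiv (𝓡 n) 𝓘(ℝ, Model n) Φ.symm v.1 v.2)

/-- The tangent vector with given position and velocity in global coordinates. -/
def ofCoord (p : Model n × Model n) : TangentBundle (𝓡 n) M :=
  ⟨Φ p.1, mfderiv 𝓘(ℝ, Model n) (𝓡 n) Φ p.1 p.2⟩

theorem coord_ofCoord (p : Model n × Model n) : Φ.coord (Φ.ofCoord p) = p :=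
  Prod.ext (Φ.symm_apply_apply p.1) (Φ.mfderiv_symm_mfderiv p.1 p.2)

theorem ofCoord_coord (v : TangentBundle (𝓡 n) M) : Φ.ofCoord (Φ.coord v) = v :=
  Φ.mfderiv_mfderiv_symm v.1 v.2

theorem coord_smul (x : M) (v : TangentSpace (𝓡 n) x) (c : ℝ) :
    Φ.coord ⟨x, c • v⟩ = ((Φ.coord ⟨x, v⟩).1, c • (Φ.coord ⟨x, v⟩).2) :=
  Prod.ext rfl (map_smul (mfderiv (𝓡 n) 𝓘(ℝ, Model n) Φ.symm x) c v)

theorem coord_lift {γ : ℝ → M} {t : ℝ} (hγ : MDifferentiableAt 𝓘(ℝ, ℝ) (𝓡 n) γ t) :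
    Φ.coord (lift γ t) = (Φ.symm (γ t), deriv (fun s ↦ Φ.symm (γ s)) t) := by
  have h := mfderiv_comp t (Φ.symm.contMDiff.mdifferentiable (by simp) (γ t)) hγ
  refine Prod.ext rfl ?_
  have h2 : mfderiv 𝓘(ℝ, ℝ) 𝓘(ℝ, Model n) (Φ.symm ∘ γ) t = fderiv ℝ (Φ.symm ∘ γ) t :=
    mfderiv_eq_fderiv
  rw [h2] at h
  exact (DFunLike.congr_fun h (1 : ℝ)).symm

variable [IsManifold (𝓡 n) ∞ M]

theorem isGeodesicOn_iff (cov : LinearConnection n M) {γ : ℝ → M} {J : Set ℝ} (hJo : IsOpen J)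
    (hJc : J.OrdConnected) (hγ : ContMDiffOn 𝓘(ℝ, ℝ) (𝓡 n) ∞ γ J) :
    IsGeodesicOn cov γ J ↔ ∀ x₀, ∀ t ∈ J, Φ.symm (γ t) ∈ Φ.chartDomain x₀ →
      deriv (deriv fun s ↦ Φ.symm (γ s)) t =
        Φ.chartAccel x₀ cov (Φ.symm (γ t), deriv (fun s ↦ Φ.symm (γ s)) t) := by
  have key : ∀ x₀, ∀ t ∈ J, (ht : Φ.symm (γ t) ∈ Φ.chartDomain x₀) → _ := fun x₀ t htJ ht ↦
    Φ.geodesic_equation_iff x₀ cov (Φ.contDiffAt_symm_comp (hγ.contMDiffAt (hJo.mem_nhds htJ))) ht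
  simp only [toChart, Φ.apply_symm_apply] at key
  have hmem : ∀ x₀ t, Φ.symm (γ t) ∈ Φ.chartDomain x₀ ↔ γ t ∈ (chartAt (Model n) x₀).source := by
    intro x₀ t
    rw [chartDomain, mem_preimage, Φ.apply_symm_apply]
  constructor
  · exact fun h x₀ t htJ ht ↦ (key x₀ t htJ ht).1 (h.equation x₀ t htJ ((hmem x₀ t).1 ht))
  · exact fun h ↦ ⟨hJo, hJc, hγ, fun x₀ t htJ ht ↦
      (key x₀ t htJ ((hmem x₀ t).2 ht)).2 (h x₀ t htJ ((hmem x₀ t).2 ht))⟩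

end GlobalChart

end Coordinates

/-! ### The geodesic flow of a pseudohadamard manifold -/

section GeodesicFlow

variable {n : ℕ} {M : Type*} [TopologicalSpace M] [ChartedSpace (Model n) M]
  [IsManifold (𝓡 n) ∞ M]

theorem IsGeodesicOn.contMDiffAt {cov : LinearConnection n M} {γ : ℝ → M} {J : Set ℝ}
    (h : IsGeodesicOn cov γ J) {t : ℝ} (ht : t ∈ J) : ContMDiffAt 𝓘(ℝ, ℝ) (𝓡 n) ∞ γ t :=
  h.smooth.contMDiffAt (h.isOpen.mem_nhds ht)

/-- On a pseudohadamard manifold every tangent vector is the velocity of a geodesic which is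
defined on `[0, 1]`. -/
theorem IsPseudohadamard.exists_geodesic {cov : LinearConnection n M} (h : IsPseudohadamard cov)
    (v : TangentBundle (𝓡 n) M) :
    ∃ (γ : ℝ → M) (J : Set ℝ), IsGeodesicOn cov γ J ∧ Icc 0 1 ⊆ J ∧ lift γ 0 = v ∧
      γ 1 = expMap cov v.1 v.2 := by
  have hv := (h v.1).1 v.2
  obtain ⟨⟨-, J, hJ, hγ⟩, h0⟩ := hv.choose_spec
  refine ⟨hv.choose, J, hγ, hJ, h0, ?_⟩
  rw [expMap, dif_pos hv]

namespace GlobalChart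

variable (Φ : GlobalChart n M)

/-- The acceleration, in global coordinates, of the geodesic with the given position and
velocity. -/
def accel (cov : LinearConnection n M) (p : Model n × Model n) : Model n :=
  Φ.chartAccel (Φ p.1) cov p

variable {cov : LinearConnection n M}

theorem coord_lift_of_isGeodesicOn {γ : ℝ → M} {J : Set ℝ} (hγ : IsGeodesicOn cov γ J) {t : ℝ}
    (ht : t ∈ J) : Φ.coord (lift γ t) = (Φ.symm (γ t), deriv (fun s ↦ Φ.symm (γ s)) t) :=
  Φ.coord_lift ((hγ.contMDiffAt ht).mdifferentiableAt (by simp))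

theorem chartAccel_coord_lift {γ : ℝ → M} {J : Set ℝ} (hγ : IsGeodesicOn cov γ J) {t : ℝ}
    (ht : t ∈ J) {x₀ : M} (hx : Φ.symm (γ t) ∈ Φ.chartDomain x₀) :
    Φ.chartAccel x₀ cov (Φ.coord (lift γ t)) = deriv (deriv fun s ↦ Φ.symm (γ s)) t := by
  rw [Φ.coord_lift_of_isGeodesicOn hγ ht]
  exact ((Φ.isGeodesicOn_iff cov hγ.isOpen hγ.ordConnected hγ.smooth).1 hγ x₀ t ht hx).symm

/-- Independence of the chart needs no transformation law for Christoffel symbols. Some geodesic has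
p as initial velocity and satisfies the equation in every chart, so each chart computes the
acceleration of that geodesic. -/
theorem chartAccel_eq_accel (h : IsPseudohadamard cov) {x₀ : M} {p : Model n × Model n}
    (hp : p.1 ∈ Φ.chartDomain x₀) : Φ.chartAccel x₀ cov p = Φ.accel cov p := by
  obtain ⟨γ, J, hγ, hJ, h0, -⟩ := h.exists_geodesic (Φ.ofCoord p)
  have h0J : (0 : ℝ) ∈ J := hJ (by simp)
  have hc : Φ.coord (lift γ 0) = p := by rw [h0, coord_ofCoord]
  have hy : Φ.symm (γ 0) = p.1 := by rw [← hc]; rfl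
  have h1 := Φ.chartAccel_coord_lift hγ h0J (x₀ := x₀) (by rwa [hy])
  have h2 := Φ.chartAccel_coord_lift hγ h0J (x₀ := Φ p.1) (by
    rw [hy]; exact Φ.mem_chartDomain_self p.1)
  rw [hc] at h1 h2
  rw [h1, accel, h2]

theorem accel_smul (y z : Model n) (c : ℝ) :
    Φ.accel cov (y, c • z) = (c * c) • Φ.accel cov (y, z) :=
  Φ.chartAccel_smul (Φ y) cov (Φ.mem_chartDomain_self y) c z

theorem contDiff_accel [T2Space M]
    (hcov : CovariantDerivative.ContMDiffCovariantDerivative cov ∞) (h : IsPseudohadamard cov) : ContDiff ℝ ∞ (Φ.accel cov) := by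
  rw [contDiff_iff_contDiffAt]
  intro p
  refine (Φ.contDiffAt_chartAccel (Φ p.1) hcov (Φ.mem_chartDomain_self p.1)).congr_of_eventuallyEq
    ?_
  filter_upwards [continuousAt_fst.eventually_mem
    ((Φ.isOpen_chartDomain _).mem_nhds (Φ.mem_chartDomain_self p.1))] with q hq
  exact (Φ.chartAccel_eq_accel h hq).symm

theorem hasDerivAt_coord_lift {γ : ℝ → M} {J : Set ℝ}
    (hγ : IsGeodesicOn cov γ J) {t : ℝ} (ht : t ∈ J) :
    HasDerivAt (fun s ↦ Φ.coord (lift γ s)) (sprayField (Φ.accel cov) (Φ.coord (lift γ t))) t := by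
  have heq : (fun s ↦ Φ.coord (lift γ s)) =ᶠ[𝓝 t]
      fun s ↦ (Φ.symm (γ s), deriv (fun s ↦ Φ.symm (γ s)) s) := by
    filter_upwards [hγ.isOpen.mem_nhds ht] with s hs
    exact Φ.coord_lift_of_isGeodesicOn hγ hs
  have hy := Φ.contDiffAt_symm_comp (hγ.contMDiffAt ht)
  have h1 : HasDerivAt (deriv fun s ↦ Φ.symm (γ s)) (deriv (deriv fun s ↦ Φ.symm (γ s)) t) t := by
    refine DifferentiableAt.hasDerivAt ?_
    have : ContDiffAt ℝ ∞ (fderiv ℝ fun s ↦ Φ.symm (γ s)) t := hy.fderiv_right (by simp)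
    exact (this.differentiableAt (by simp)).clm_apply (differentiableAt_const (1 : ℝ))
  refine (((hy.differentiableAt (by simp)).hasDerivAt.prodMk h1).congr_of_eventuallyEq
    heq).congr_deriv ?_
  rw [sprayField, accel, Φ.chartAccel_coord_lift hγ ht]
  · rw [Φ.coord_lift_of_isGeodesicOn hγ ht]
  · exact Φ.mem_chartDomain_self _

/-- `φ` is the geodesic flow of `cov` in the global coordinates `Φ`. -/
structure IsGeodesicFlow (Φ : GlobalChart n M) (cov : LinearConnection n M)
    (φ : ℝ → Model n × Model n → Model n × Model n) : Prop where
  isPoleFlow : IsPoleFlow φ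
  coord_lift : ∀ γ J, IsGeodesicOn cov γ J → ∀ t₀ ∈ J, ∀ t ∈ J,
    Φ.coord (lift γ t) = φ (t - t₀) (Φ.coord (lift γ t₀))
  isGeodesicOn : ∀ p, IsGeodesicOn cov (fun t ↦ Φ (φ t p).1) univ

theorem exists_isGeodesicFlow [T2Space M]
    (hcov : CovariantDerivative.ContMDiffCovariantDerivative cov ∞) (h : IsPseudohadamard cov) :
    ∃ φ, Φ.IsGeodesicFlow cov φ := by
  have hX := Φ.contDiff_accel hcov h
  have hF : ContDiff ℝ ∞ (sprayField (Φ.accel cov)) := contDiff_snd.prodMk hX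
  obtain ⟨φ, h0, hφ⟩ := exists_flow_of_homogeneous hX Φ.accel_smul (fun p ↦ by
    obtain ⟨γ, J, hγ, hJ, hγ0, -⟩ := h.exists_geodesic (Φ.ofCoord p)
    exact ⟨fun t ↦ Φ.coord (lift γ t), J, hγ.isOpen, hγ.ordConnected, hJ,
      (congrArg Φ.coord hγ0).trans (Φ.coord_ofCoord p), fun t ht ↦ Φ.hasDerivAt_coord_lift hγ ht⟩)
  have hsm := GeodesicSpace.contDiff_flow hF h0 hφ
  have hd : ∀ p t, HasDerivAt (fun s ↦ (φ s p).1) (φ t p).2 t := fun p t ↦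
    (ContinuousLinearMap.fst ℝ (Model n) (Model n)).hasFDerivAt.comp_hasDerivAt t (hφ p t)
  have hlift : ∀ γ J, IsGeodesicOn cov γ J → ∀ t₀ ∈ J, ∀ t ∈ J,
      Φ.coord (lift γ t) = φ (t - t₀) (Φ.coord (lift γ t₀)) := by
    intro γ J hγ t₀ ht₀ t ht
    refine eqOn_of_hasDerivAt hF hγ.ordConnected (β := fun t ↦ φ (t - t₀) (Φ.coord (lift γ t₀)))
      (fun s hs ↦ Φ.hasDerivAt_coord_lift hγ hs) (fun s _ ↦ ?_) ht₀ (by simp [h0]) ht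
    exact (hφ _ (s - t₀)).comp_sub_const s t₀
  have hexp : ∀ x v, (φ 1 (x, v)).1 = Φ.symm (expMap cov (Φ x)
      (mfderiv 𝓘(ℝ, Model n) (𝓡 n) Φ x v)) := by
    intro x v
    obtain ⟨γ, J, hγ, hJ, hγ0, hγ1⟩ := h.exists_geodesic (Φ.ofCoord (x, v))
    have := hlift γ J hγ 0 (hJ (by simp)) 1 (hJ (by simp))
    rw [hγ0, coord_ofCoord, sub_zero] at this
    rw [← this]
    exact congrArg Φ.symm hγ1
  -- The diffeomorphism given by the pole Φ x, read in global coordinates, provides a smooth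
  -- two-sided inverse of the time-one map. Bijectivity follows, and the chain rule gives
  -- injectivity of the derivative.
  have hleft : ∀ x, ∃ k : Model n → Model n, ContDiff ℝ ∞ k ∧
      Function.LeftInverse k (fun v ↦ (φ 1 (x, v)).1) ∧
      Function.RightInverse k (fun v ↦ (φ 1 (x, v)).1) := by
    intro x
    obtain ⟨Ψ, hΨ⟩ := (h (Φ x)).2
    let L : Model n →L[ℝ] Model n := mfderiv 𝓘(ℝ, Model n) (𝓡 n) Φ x
    let L' : Model n →L[ℝ] Model n := mfderiv (𝓡 n) 𝓘(ℝ, Model n) Φ.symm (Φ x)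
    have hL' : Function.LeftInverse L' L := Φ.mfderiv_symm_mfderiv x
    have hL : Function.LeftInverse L L' := hL'.rightInverse_of_surjective
      ((LinearMap.injective_iff_surjective (f := (L : Model n →ₗ[ℝ] Model n))).1 hL'.injective)
    have hexp' : ∀ v : Model n, (φ 1 (x, v)).1 = Φ.symm (Ψ (L v)) := fun v ↦
      (hexp x v).trans (congrArg Φ.symm (hΨ (L v)).symm)
    refine ⟨fun y ↦ L' (Ψ.symm (Φ y)), L'.contDiff.comp ?_, fun v ↦ ?_, fun y ↦ ?_⟩
    · rw [← contMDiff_iff_contDiff]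
      exact Ψ.symm.contMDiff.comp Φ.contMDiff
    · simp only [hexp', Φ.apply_symm_apply, Ψ.symm_apply_apply]
      exact hL' v
    · simp only [hexp', hL _, Ψ.apply_symm_apply, Φ.symm_apply_apply]
  refine ⟨φ, ⟨hsm, h0, fun s t p ↦ flow_add hF h0 hφ s t p, hd, ?_, ?_, ?_⟩, hlift, ?_⟩
  · exact flow_smul_of_homogeneous hX Φ.accel_smul h0 hφ
  · intro x
    obtain ⟨k, -, hk1, hk2⟩ := hleft x
    exact ⟨hk1.injective, hk2.surjective⟩
  · intro x v
    obtain ⟨k, hk, hk1, -⟩ := hleft x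
    have hg : ContDiff ℝ ∞ fun v ↦ (φ 1 (x, v)).1 :=
      contDiff_fst.comp (hsm.comp (contDiff_const.prodMk (contDiff_const.prodMk contDiff_id)))
    have hc := (hk.differentiable (by simp) ((φ 1 (x, v)).1)).hasFDerivAt.comp v
      (hg.differentiable (by simp) v).hasFDerivAt
    have hid : HasFDerivAt (k ∘ fun v ↦ (φ 1 (x, v)).1) (ContinuousLinearMap.id ℝ _) v := by
      rw [hk1.comp_eq_id]
      exact hasFDerivAt_id v
    exact Function.LeftInverse.injective (DFunLike.congr_fun (hc.unique hid))
  · intro p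
    have hsp : ContDiff ℝ ∞ fun t ↦ (φ t p).1 :=
      contDiff_fst.comp (hsm.comp (contDiff_id.prodMk contDiff_const))
    have hs : ContMDiff 𝓘(ℝ, ℝ) (𝓡 n) ∞ fun t ↦ Φ (φ t p).1 :=
      Φ.contMDiff.comp hsp.contMDiff
    rw [Φ.isGeodesicOn_iff cov isOpen_univ ordConnected_univ hs.contMDiffOn]
    simp only [Φ.symm_apply_apply]
    intro x₀ t _ hx
    have hd1 : (deriv fun s ↦ (φ s p).1) = fun s ↦ (φ s p).2 := funext fun s ↦ (hd p s).deriv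
    rw [hd1, Φ.chartAccel_eq_accel h hx]
    exact ((ContinuousLinearMap.snd ℝ (Model n) (Model n)).hasFDerivAt.comp_hasDerivAt t
      (hφ p t)).deriv

end GlobalChart

end GeodesicFlow

/-- The logarithm of the position at time T is T • p.2, so the arc up to T is the segment between
its endpoints, run through by r = s / T. For T = 0 the division gives 0, and s = 0 as well. -/
theorem IsPoleFlow.exists_flow_eq_segment {E : Type*} [NormedAddCommGroup E] [NormedSpace ℝ E]
    {φ : ℝ → E × E → E × E} (h : IsPoleFlow φ) (p : E × E) {s T : ℝ} (hs : s ∈ Icc 0 T) :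
    ∃ r ∈ Icc (0 : ℝ) 1, (φ s p).1 = (φ r (p.1, h.log p.1 (φ T p).1)).1 := by
  have hT : 0 ≤ T := hs.1.trans hs.2
  refine ⟨s / T, ⟨div_nonneg hs.1 hT, div_le_one_of_le₀ hs.2 hT⟩, ?_⟩
  have hsT : T * (s / T) = s := by
    rcases eq_or_ne T 0 with rfl | hT0
    · rw [zero_mul, le_antisymm hs.2 hs.1]
    · exact mul_div_cancel₀ s hT0
  rw [show h.log p.1 (φ T p).1 = T • p.2 from h.log_flow T p.1 p.2, h.smul, hsT]

/-! ### Pseudoconvexity and the nonreturning property -/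

namespace GlobalChart.IsGeodesicFlow

variable {n : ℕ} {M : Type*} [TopologicalSpace M] [ChartedSpace (Model n) M]
  [IsManifold (𝓡 n) ∞ M] {Φ : GlobalChart n M} {cov : LinearConnection n M}
  {φ : ℝ → Model n × Model n → Model n × Model n}

theorem apply_eq (h : Φ.IsGeodesicFlow cov φ) {γ : ℝ → M} {J : Set ℝ}
    (hγ : IsGeodesicOn cov γ J) {t₀ t : ℝ} (ht₀ : t₀ ∈ J) (ht : t ∈ J) :
    Φ.symm (γ t) = (φ (t - t₀) (Φ.coord (lift γ t₀))).1 := by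
  rw [← h.coord_lift γ J hγ t₀ ht₀ t ht]
  rfl

theorem coord_lift_flow (h : Φ.IsGeodesicFlow cov φ) (p : Model n × Model n) (t : ℝ) :
    Φ.coord (lift (fun t ↦ Φ (φ t p).1) t) = φ t p := by
  rw [Φ.coord_lift_of_isGeodesicOn (h.isGeodesicOn p) (mem_univ t)]
  simp only [Φ.symm_apply_apply, (h.isPoleFlow.hasDerivAt p t).deriv]

theorem isMaximalGeodesic (h : Φ.IsGeodesicFlow cov φ) (p : Model n × Model n) :
    IsMaximalGeodesic cov (fun t ↦ Φ (φ t p).1) univ :=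
  ⟨h.isGeodesicOn p, univ_nonempty, fun _ _ _ hJ _ ↦ univ_subset_iff.1 hJ⟩

/-- The flow line through any velocity of γ extends γ to all of ℝ, so maximality forces the domain
to be ℝ. -/
theorem eq_univ (h : Φ.IsGeodesicFlow cov φ) {γ : ℝ → M} {J : Set ℝ}
    (hγ : IsMaximalGeodesic cov γ J) : J = univ := by
  obtain ⟨t₀, ht₀⟩ := hγ.nonempty
  refine (hγ.maximal _ univ (h.isGeodesicOn (φ (-t₀) (Φ.coord (lift γ t₀)))) (subset_univ J)
    fun t ht ↦ ?_).symm
  rw [← h.isPoleFlow.add, ← sub_eq_add_neg, ← h.apply_eq hγ.geodesic ht₀ ht, Φ.apply_symm_apply]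

theorem isPseudoconvex (h : Φ.IsGeodesicFlow cov φ) : IsPseudoconvex cov := by
  intro K hK
  obtain ⟨K', hK', hKK'⟩ := h.isPoleFlow.exists_isCompact_segment (hK.image Φ.symm.continuous)
  refine ⟨Φ '' K', hK'.image Φ.continuous, ?_⟩
  rintro γ a b ⟨hab, J, hJ, hγ⟩ ha hb t ht
  have haJ := hJ (left_mem_Icc.2 hab)
  refine ⟨Φ.symm (γ t), ?_, Φ.apply_symm_apply _⟩
  obtain ⟨r, hr, hrt⟩ := h.isPoleFlow.exists_flow_eq_segment (Φ.coord (lift γ a))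
    (s := t - a) (T := b - a) ⟨sub_nonneg.2 ht.1, sub_le_sub_right ht.2 a⟩
  rw [h.apply_eq hγ haJ (hJ ht), hrt, ← h.apply_eq hγ haJ (hJ (right_mem_Icc.2 hab))]
  exact hKK' _ (mem_image_of_mem _ ha) _ (mem_image_of_mem _ hb) r hr

theorem isSimpleConvex (h : Φ.IsGeodesicFlow cov φ) {B : Set (Model n)} (hB : IsOpen B)
    (hconv : ∀ x ∈ B, ∀ y ∈ B, ∀ t ∈ Icc (0 : ℝ) 1, (φ t (x, h.isPoleFlow.log x y)).1 ∈ B) :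
    IsSimpleConvex cov (Φ.symm ⁻¹' B) := by
  refine ⟨hB.preimage Φ.symm.continuous, fun x hx y hy ↦ ?_⟩
  set w := h.isPoleFlow.log (Φ.symm x) (Φ.symm y) with hw
  obtain ⟨v, hv⟩ : ∃ v : TangentSpace (𝓡 n) x, Φ.coord ⟨x, v⟩ = (Φ.symm x, w) := by
    -- The base point Φ (Φ.symm x) equals x only propositionally, so the vector must be moved to the
    -- fibre over x.
    have hmk : ∀ q : TangentBundle (𝓡 n) M, q.1 = x → ∃ v : TangentSpace (𝓡 n) x, q = ⟨x, v⟩ := by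
      rintro q rfl
      exact ⟨q.2, rfl⟩
    obtain ⟨v, hv⟩ := hmk (Φ.ofCoord (Φ.symm x, w)) (Φ.apply_symm_apply x)
    exact ⟨v, by rw [← hv, coord_ofCoord]⟩
  refine ⟨v, ⟨fun t ↦ Φ (φ t (Φ.symm x, w)).1,
    ⟨zero_le_one, univ, subset_univ _, h.isGeodesicOn _⟩, ?_, ?_, fun t ht ↦ ?_⟩, ?_⟩
  · rw [← Φ.ofCoord_coord ⟨x, v⟩, hv, ← Φ.ofCoord_coord (lift _ 0), h.coord_lift_flow,
      h.isPoleFlow.zero]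
  · simp only [hw, h.isPoleFlow.exp_log, Φ.apply_symm_apply]
  · rw [mem_preimage, Φ.symm_apply_apply]
    exact hconv _ hx _ hy t ht
  -- Uniqueness is global: injectivity of exp_x suffices, whether or not the competing segment stays
  -- in the set.
  · rintro v' ⟨γ, ⟨-, J, hJ, hγ⟩, h0, h1, -⟩
    have h2 := h.apply_eq hγ (hJ (left_mem_Icc.2 zero_le_one)) (hJ (right_mem_Icc.2 zero_le_one))
    rw [h0, h1, sub_zero] at h2
    have h3 : Φ.coord ⟨x, v'⟩ = (Φ.symm x, w) := by
      refine Prod.ext rfl ?_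
      rw [hw, h2]
      exact (h.isPoleFlow.log_exp _ _).symm
    have h4 := congrArg Φ.ofCoord (h3.trans hv.symm)
    rw [ofCoord_coord, ofCoord_coord] at h4
    exact TotalSpace.mk_inj.1 h4

theorem isNonreturning (h : Φ.IsGeodesicFlow cov φ) : IsNonreturning cov := by
  intro p V hV
  obtain ⟨ε, hε, hεV, hconv⟩ := h.isPoleFlow.exists_convex_ball (Φ.symm p)
    (V := Φ ⁻¹' V) (Φ.continuous.continuousAt.preimage_mem_nhds (by rwa [Φ.apply_symm_apply]))
  refine ⟨Φ.symm ⁻¹' Metric.ball (Φ.symm p) ε, fun x hx ↦ ?_, Metric.mem_ball_self hε,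
    h.isSimpleConvex Metric.isOpen_ball hconv, ?_⟩
  · have := hεV (Metric.ball_subset_closedBall hx)
    rwa [mem_preimage, Φ.apply_symm_apply] at this
  intro γ J hγ hnt t ht htU
  obtain rfl := h.eq_univ hγ
  set q := Φ.coord (lift γ t)
  have hγq : ∀ s, Φ.symm (γ s) = (φ (s - t) q).1 := fun s ↦
    h.apply_eq hγ.geodesic ht (mem_univ s)
  refine ⟨?_, fun s _ hts hs r _ hsr hr ↦ hs ?_⟩
  · have hq0 : q.2 ≠ 0 := by
      intro hq0
      obtain ⟨_, ⟨a, -, rfl⟩, _, ⟨b, -, rfl⟩, hab⟩ := hnt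
      refine hab (Φ.symm.injective ?_)
      change Φ.symm (γ a) = Φ.symm (γ b)
      rw [hγq, hγq, show q = (q.1, 0) from Prod.ext rfl hq0, h.isPoleFlow.flow_zero_right,
        h.isPoleFlow.flow_zero_right]
    obtain ⟨s, hs, hsB⟩ := h.isPoleFlow.exists_flow_notMem
      (isCompact_closedBall (Φ.symm p) ε) hq0
    refine ⟨t + s, mem_univ _, lt_add_of_pos_right t hs, fun hmem ↦ hsB ?_⟩
    rw [mem_preimage, hγq, add_sub_cancel_left] at hmem
    exact Metric.ball_subset_closedBall hmem
  -- Had γ returned at time r, the point at time s would lie on the segment between two points of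
  -- the convex ball, hence in the ball.
  · obtain ⟨a, ha, hsa⟩ := h.isPoleFlow.exists_flow_eq_segment q
      (s := s - t) (T := r - t) ⟨sub_nonneg.2 hts.le, sub_le_sub_right hsr.le t⟩
    rw [mem_preimage, hγq, hsa, ← hγq]
    exact hconv _ htU _ hr a ha

end GlobalChart.IsGeodesicFlow

/-! ### The space of geodesics as an orbit space -/

variable {n : ℕ} {M : Type*} [TopologicalSpace M] [ChartedSpace (Model n) M]

namespace GlobalChart

variable (Φ : GlobalChart n M)

theorem coord_snd_ne_zero {v : TangentBundle (𝓡 n) M} (hv : v.2 ≠ 0) : (Φ.coord v).2 ≠ 0 := by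
  intro h
  have h0 : (Φ.ofCoord (Φ.coord v)).2 = 0 := by
    change mfderiv 𝓘(ℝ, Model n) (𝓡 n) Φ (Φ.coord v).1 (Φ.coord v).2 = 0
    rw [h]
    exact map_zero (mfderiv 𝓘(ℝ, Model n) (𝓡 n) Φ (Φ.coord v).1)
  rw [Φ.ofCoord_coord] at h0
  exact hv h0

theorem ofCoord_snd_ne_zero {p : Model n × Model n} (hp : p.2 ≠ 0) : (Φ.ofCoord p).2 ≠ 0 := by
  intro h
  have h0 : (Φ.coord (Φ.ofCoord p)).2 = 0 := by
    change mfderiv (𝓡 n) 𝓘(ℝ, Model n) Φ.symm (Φ.ofCoord p).1 (Φ.ofCoord p).2 = 0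
    rw [h]
    exact map_zero (mfderiv (𝓡 n) 𝓘(ℝ, Model n) Φ.symm (Φ.ofCoord p).1)
  rw [Φ.coord_ofCoord] at h0
  exact hp h0

variable [IsManifold (𝓡 n) ∞ M]

theorem contMDiff_coord : ContMDiff (𝓡 n).tangent 𝓘(ℝ, Model n × Model n) ∞ Φ.coord := by
  have h1 : ContMDiff (𝓡 n).tangent 𝓘(ℝ, Model n).tangent ∞
      (tangentMap (𝓡 n) 𝓘(ℝ, Model n) Φ.symm) :=
    Φ.symm.contMDiff.contMDiff_tangentMap (by simp)
  exact (Φ.symm.contMDiff.comp (contMDiff_proj (TangentSpace (𝓡 n) : M → Type _))).prodMk_space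
    ((contMDiff_snd_tangentBundle_modelSpace (Model n) 𝓘(ℝ, Model n)).comp h1)

theorem contMDiff_ofCoord : ContMDiff 𝓘(ℝ, Model n × Model n) (𝓡 n).tangent ∞ Φ.ofCoord := by
  have h1 : ContMDiff 𝓘(ℝ, Model n).tangent (𝓡 n).tangent ∞
      (tangentMap 𝓘(ℝ, Model n) (𝓡 n) Φ) :=
    Φ.contMDiff.contMDiff_tangentMap (by simp)
  refine h1.comp
    (f := fun p : Model n × Model n ↦ (⟨p.1, p.2⟩ : TangentBundle 𝓘(ℝ, Model n) (Model n))) fun p ↦ ?_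
  refine Bundle.contMDiffAt_totalSpace.2 ⟨contDiff_fst.contMDiff.contMDiffAt, ?_⟩
  convert! contDiff_snd.contMDiff.contMDiffAt (x := p) with q
  simp only [trivializationAt_model_space_apply]
  rfl

open Classical in
/-- The reduced tangent vector with the given global coordinates (and the junk value `v₁` where
the velocity vanishes). -/
def ofCoordReduced (v₁ : reducedTangentBundle n M) (p : Model n × Model n) :
    reducedTangentBundle n M :=
  if hp : p.2 ≠ 0 then ⟨Φ.ofCoord p, Φ.ofCoord_snd_ne_zero hp⟩ else v₁

theorem coe_ofCoordReduced (v₁ : reducedTangentBundle n M) {p : Model n × Model n}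
    (hp : p.2 ≠ 0) : (Φ.ofCoordReduced v₁ p : TangentBundle (𝓡 n) M) = Φ.ofCoord p := by
  rw [ofCoordReduced, dif_pos hp]

theorem ofCoordReduced_coord (v₁ v : reducedTangentBundle n M) :
    Φ.ofCoordReduced v₁ (Φ.coord v) = v :=
  Subtype.ext ((Φ.coe_ofCoordReduced v₁ (Φ.coord_snd_ne_zero v.2)).trans (Φ.ofCoord_coord _))

theorem eventuallyEq_coe_ofCoordReduced (v₁ : reducedTangentBundle n M) {p : Model n × Model n}
    (hp : p.2 ≠ 0) :
    (fun q ↦ (Φ.ofCoordReduced v₁ q : TangentBundle (𝓡 n) M)) =ᶠ[𝓝 p] Φ.ofCoord := by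
  filter_upwards [continuousAt_snd.eventually_ne hp] with q hq
  exact Φ.coe_ofCoordReduced v₁ hq

theorem contMDiffAt_ofCoordReduced (v₁ : reducedTangentBundle n M) {p : Model n × Model n}
    (hp : p.2 ≠ 0) :
    ContMDiffAt 𝓘(ℝ, Model n × Model n) (𝓡 n).tangent ∞ (Φ.ofCoordReduced v₁) p := by
  rw [← ContMDiffAt.subtypeVal_comp_iff]
  exact Φ.contMDiff_ofCoord.contMDiffAt.congr_of_eventuallyEq
    (Φ.eventuallyEq_coe_ofCoordReduced v₁ hp)

theorem contMDiff_coord_coe : ContMDiff (𝓡 n).tangent 𝓘(ℝ, Model n × Model n) ∞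
    fun v : reducedTangentBundle n M ↦ Φ.coord v :=
  Φ.contMDiff_coord.comp contMDiff_subtype_val

theorem mfderiv_coord_surjective (v : reducedTangentBundle n M) :
    Function.Surjective (mfderiv (𝓡 n).tangent 𝓘(ℝ, Model n × Model n)
      (fun v : reducedTangentBundle n M ↦ Φ.coord v) v) := by
  have hp := Φ.coord_snd_ne_zero v.2
  have h := mfderiv_comp (Φ.coord v) (Φ.contMDiff_coord_coe.mdifferentiable (by simp) _)
    ((Φ.contMDiffAt_ofCoordReduced v hp).mdifferentiableAt (by simp))
  have hid : (fun v : reducedTangentBundle n M ↦ Φ.coord v) ∘ Φ.ofCoordReduced v =ᶠ[𝓝 (Φ.coord v)]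
      id := by
    filter_upwards [Φ.eventuallyEq_coe_ofCoordReduced v hp] with q hq
    exact (congrArg Φ.coord hq).trans (Φ.coord_ofCoord q)
  rw [hid.mfderiv_eq, mfderiv_id] at h
  have hsurj : Function.Surjective (mfderiv (𝓡 n).tangent 𝓘(ℝ, Model n × Model n)
      (fun v : reducedTangentBundle n M ↦ Φ.coord v) (Φ.ofCoordReduced v (Φ.coord v))) :=
    fun w ↦ ⟨_, (DFunLike.congr_fun h w).symm⟩
  rwa [Φ.ofCoordReduced_coord] at hsurj

namespace IsGeodesicFlow

variable {Φ} {cov : LinearConnection n M} {φ : ℝ → Model n × Model n → Model n × Model n}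

theorem toGeodesics_eq_iff (h : Φ.IsGeodesicFlow cov φ) (v w : reducedTangentBundle n M) :
    toGeodesics cov v = toGeodesics cov w ↔ OrbitRel φ (Φ.coord v) (Φ.coord w) := by
  constructor
  -- `Quot` identifies points by the equivalence generated by `OnCommonGeodesic`. Factoring the
  -- orbit projection through both quotients shows that this equivalence is no coarser than the
  -- orbit relation.
  · let s : Setoid (reducedTangentBundle n M) :=
      { r := fun v w ↦ OrbitRel φ (Φ.coord v) (Φ.coord w)
        iseqv := ⟨fun v ↦ h.isPoleFlow.orbitRel_refl _, h.isPoleFlow.orbitRel_symm,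
          h.isPoleFlow.orbitRel_trans⟩ }
    have h1 : ∀ v w, proportional n M v w → Quotient.mk s v = Quotient.mk s w := by
      rintro v w ⟨c, hc, hw⟩
      refine Quotient.sound ⟨0, c, hc, ?_⟩
      rw [hw, Φ.coord_smul, flowScale, h.isPoleFlow.zero]
    have h2 : ∀ P Q, OnCommonGeodesic cov P Q →
        Quotient.lift (Quotient.mk s) h1 P = Quotient.lift (Quotient.mk s) h1 Q := by
      rintro P Q ⟨γ, J, hγ, a, ha, b, hb, v, w, hv, hw, rfl, rfl⟩
      refine Quotient.sound ⟨b - a, 1, one_ne_zero, ?_⟩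
      rw [hv, hw, h.coord_lift γ J hγ.geodesic a ha b hb, flowScale, one_smul]
    exact fun hvw ↦ Quotient.exact (congrArg (Quot.lift _ h2) hvw)
  · rintro ⟨t, c, hc, hw⟩
    have hlift : ∀ a, lift (fun t ↦ Φ (φ t (Φ.coord v)).1) a = Φ.ofCoord (φ a (Φ.coord v)) := by
      intro a
      rw [← h.coord_lift_flow (Φ.coord v) a, Φ.ofCoord_coord]
    let u : reducedTangentBundle n M := ⟨Φ.ofCoord (φ t (Φ.coord v)), Φ.ofCoord_snd_ne_zero
      (h.isPoleFlow.flow_snd_ne_zero t (Φ.coord_snd_ne_zero v.2))⟩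
    have hvu : toGeodesics cov v = toGeodesics cov u :=
      Quot.sound ⟨_, univ, h.isMaximalGeodesic (Φ.coord v), 0, mem_univ _, t, mem_univ _, v, u,
        by rw [hlift, h.isPoleFlow.zero, Φ.ofCoord_coord], (hlift t).symm, rfl, rfl⟩
    have huw : proportional n M u w := by
      refine ⟨c, hc, ?_⟩
      rw [← Φ.ofCoord_coord w, hw, ← Φ.ofCoord_coord ⟨u.1.proj, c • u.1.2⟩, Φ.coord_smul]
      change _ = Φ.ofCoord ((Φ.coord (Φ.ofCoord (φ t (Φ.coord v)))).1,
        c • (Φ.coord (Φ.ofCoord (φ t (Φ.coord v)))).2)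
      rw [Φ.coord_ofCoord, flowScale]
    exact hvu.trans (congrArg (Quot.mk _) (Quotient.sound huw))

theorem isOrbitMap (h : Φ.IsGeodesicFlow cov φ) (v₁ : reducedTangentBundle n M) :
    IsOrbitMap φ fun p ↦ toGeodesics cov (Φ.ofCoordReduced v₁ p) where
  surj q := by
    obtain ⟨P, rfl⟩ := Quot.exists_rep q
    obtain ⟨v, rfl⟩ := Quotient.exists_rep P
    exact ⟨Φ.coord v, Φ.coord_snd_ne_zero v.2, congrArg (toGeodesics cov)
      (Φ.ofCoordReduced_coord v₁ v)⟩
  isOpen_iff W := by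
    have hq : IsQuotientMap (toGeodesics cov) :=
      isQuotientMap_quot_mk.comp isQuotientMap_quotient_mk'
    rw [← hq.isOpen_preimage]
    constructor
    · intro hW
      have hval : IsOpen (Subtype.val '' (toGeodesics cov ⁻¹' W)) :=
        (isOpen_nonzero n M).isOpenMap_subtype_val _ hW
      convert hval.preimage Φ.contMDiff_ofCoord.continuous using 1
      ext p
      constructor
      · rintro ⟨hp, hpW⟩
        exact ⟨Φ.ofCoordReduced v₁ p, hpW, Φ.coe_ofCoordReduced v₁ hp⟩
      · rintro ⟨v, hvW, hv⟩
        have hpv : p = Φ.coord v := by rw [hv, Φ.coord_ofCoord]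
        refine ⟨hpv ▸ Φ.coord_snd_ne_zero v.2, ?_⟩
        rw [hpv, Φ.ofCoordReduced_coord]
        exact hvW
    · intro hW
      convert hW.preimage Φ.contMDiff_coord_coe.continuous using 1
      ext v
      simp only [mem_preimage, mem_ofPred_eq, Φ.ofCoordReduced_coord]
      exact (and_iff_right (Φ.coord_snd_ne_zero v.2)).symm
  eq_iff p q hp hq := by
    rw [h.toGeodesics_eq_iff, Φ.coe_ofCoordReduced v₁ hp, Φ.coe_ofCoordReduced v₁ hq,
      Φ.coord_ofCoord, Φ.coord_ofCoord]

theorem geodesicsFormManifold (hn : 1 ≤ n) [Nonempty M] (h : Φ.IsGeodesicFlow cov φ) :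
    GeodesicsFormManifold cov := by
  have hfin : Module.finrank ℝ (Model n) = n := finrank_euclideanSpace_fin
  have : Nontrivial (Model n) := Module.nontrivial_of_finrank_pos (R := ℝ) (by rw [hfin]; exact hn)
  obtain ⟨z, hz⟩ := exists_ne (0 : Model n)
  let v₁ : reducedTangentBundle n M := ⟨Φ.ofCoord (0, z), Φ.ofCoord_snd_ne_zero hz⟩
  have hpr := h.isOrbitMap v₁
  have hk : 2 * n - 2 = 2 * Module.finrank ℝ (Model n) - 2 := by rw [hfin]
  refine ⟨hpr.t2Space h.isPoleFlow, hpr.paracompactSpace h.isPoleFlow,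
    hpr.connectedSpace h.isPoleFlow (by rw [hfin]; exact hn), hpr.chartedSpace h.isPoleFlow hk,
    hpr.isManifold h.isPoleFlow hk, ?_⟩
  let _ := hpr.chartedSpace h.isPoleFlow hk
  have heq : toGeodesics cov = (fun p ↦ toGeodesics cov (Φ.ofCoordReduced v₁ p)) ∘
      fun v : reducedTangentBundle n M ↦ Φ.coord v :=
    funext fun v ↦ (congrArg (toGeodesics cov) (Φ.ofCoordReduced_coord v₁ v)).symm
  have hsm := fun v : reducedTangentBundle n M ↦
    hpr.contMDiffAt h.isPoleFlow hk (Φ.coord_snd_ne_zero v.2)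
  refine ⟨fun v ↦ ?_, fun v ↦ ?_⟩
  · exact ((hsm v).comp v Φ.contMDiff_coord_coe.contMDiffAt).congr_of_eventuallyEq
      heq.eventuallyEq
  -- The type of the derivative depends on the map itself, so the factorization is substituted for a
  -- variable f rather than rewritten.
  · have hcomp : ∀ f : reducedTangentBundle n M → GeodesicsOf cov,
        f = (fun p ↦ toGeodesics cov (Φ.ofCoordReduced v₁ p)) ∘
          (fun v : reducedTangentBundle n M ↦ Φ.coord v) →
        Function.Surjective (mfderiv (𝓡 n).tangent (𝓡 (2 * n - 2)) f v) := by
      rintro _ rfl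
      rw [mfderiv_comp v ((hsm v).mdifferentiableAt (by simp))
        (Φ.contMDiff_coord_coe.mdifferentiable (by simp) v)]
      exact (hpr.mfderiv_surjective h.isPoleFlow hk (Φ.coord_snd_ne_zero v.2)).comp
        (Φ.mfderiv_coord_surjective v)
    exact hcomp _ heq

end IsGeodesicFlow

end GlobalChart

end GeodesicSpace

end

theorem mainTheorem8 {n : ℕ} (hn : 1 ≤ n) {M : Type*} [TopologicalSpace M] [T2Space M]
    [ParacompactSpace M] [ConnectedSpace M] [ChartedSpace (GeodesicSpace.Model n) M]
    [IsManifold (𝓡 n) ∞ M] (cov : GeodesicSpace.LinearConnection n M)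
    (hcov : CovariantDerivative.ContMDiffCovariantDerivative cov ∞)
    (hpole : GeodesicSpace.IsPseudohadamard cov) :
    GeodesicSpace.IsNonreturning cov ∧ GeodesicSpace.IsPseudoconvex cov ∧
      GeodesicSpace.GeodesicsFormManifold cov := by
  obtain ⟨x⟩ := (inferInstance : Nonempty M)
  -- The diffeomorphism at any single pole serves as the global chart.
  obtain ⟨Φ, -⟩ := (hpole x).2
  obtain ⟨φ, h⟩ := GeodesicSpace.GlobalChart.exists_isGeodesicFlow Φ hcov hpole
  have : Nonempty M := ⟨x⟩
  exact ⟨h.isNonreturning, h.isPseudoconvex, h.geodesicsFormManifold hn⟩
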